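/- Let $p>1$ be a real number. There exists a unique nonnegative function $U\in C^2(\mathbb{R})$ such that $$-U''(x)-xU(x)+|U(x)|^pU(x)=0,\quad x\in\mathbb{R},$$ and $$U(x)\to 0 \ \text{ as } x\to-\infty,\qquad U(x)-x^{\frac1p}\to 0 \ \text{ as } x\to+\infty.$$ Furthermore, $U'(x)>0$ for all $x\in\mathbb{R}$, and $$U(x)=\mathcal{O}\left(|x|^{-\frac14}e^{-\frac23|x|^{\frac32}}\right)\ \text{ as } x\to-\infty,\qquad U(x)-x^{\frac1p}=\mathcal{O}\left(x^{\frac{1-3p}{p}}\right)\ \text{ as } x\to+\infty.$$ The solution $U$ is non-degenerate, in the sense that the only bounded solution $\phi\in C^2(\mathbb{R})$ of $$\phi''-\left[(p+1)U^p-x\right]\phi=0,\quad x\in\mathbb{R},$$ is $\phi\equiv 0$. -/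

import Mathlib

open Filter Topology Asymptotics

/-- `u` is a classical (`C²`) solution of `-u'' - x u + |u|^p u = 0` on the whole real line. -/
def IsGenPainleveSolution (p : ℝ) (u : ℝ → ℝ) : Prop :=
  ContDiff ℝ 2 u ∧ ∀ x : ℝ, -deriv (deriv u) x - x * u x + |u x| ^ p * u x = 0

/-- `u` is a nonnegative classical solution of `-u'' - x u + |u|^p u = 0` on `ℝ` with
`u(x) → 0` as `x → -∞` and `u(x) - x^{1/p} → 0` as `x → +∞`. -/
structure IsGenHastingsMcLeod (p : ℝ) (u : ℝ → ℝ) : Prop where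
  solution : IsGenPainleveSolution p u
  nonneg : ∀ x : ℝ, 0 ≤ u x
  tendsto_atBot : Tendsto u atBot (𝓝 0)
  tendsto_atTop : Tendsto (fun x : ℝ => u x - x ^ (1 / p)) atTop (𝓝 0)

/-- `U` is non-degenerate: every bounded classical solution `φ` of the linearized equation
`φ'' - [(p+1) U^p - x] φ = 0` on `ℝ` is identically zero. -/
def IsNonDegenerate (p : ℝ) (U : ℝ → ℝ) : Prop :=
  ∀ φ : ℝ → ℝ, ContDiff ℝ 2 φ →
    (∀ x : ℝ, deriv (deriv φ) x - ((p + 1) * U x ^ p - x) * φ x = 0) →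
    (∃ C : ℝ, ∀ x : ℝ, |φ x| ≤ C) →
    ∀ x : ℝ, φ x = 0

/-! Everything rests on one Wronskian argument. If `ψ > 0` and `w'' ψ ≥ w ψ''` wherever `w > 0`,
then `W = w' ψ - w ψ'` is nondecreasing there and `(w / ψ)' = W / ψ²`. From a point with `w > 0`,
the ratio `w / ψ` therefore cannot fall to the right if `W ≥ 0`, nor to the left if `W ≤ 0`.
Suitable behaviour at the ends contradicts this, which yields `w ≤ 0`.

Existence comes from monotone iteration: a linear problem with a quadratic potential, large enough
to make the right-hand side monotone, is solved repeatedly from the supersolution `upperBarrier`.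
The iterates decrease and stay above every Gaussian subsolution `lowerBarrier p c`. The limit has
only polynomial growth and the lower bound `(x - 2)^(1/p)`, but comparison with an Airy-type barrier
on the left and with multiples of `x^(1/p - 3)` on the right upgrades this to the sharp asymptotics,
hence to the boundary conditions (`isBigO_atBot_of_solution`, `isBigO_atTop_of_solution`).

Uniqueness, monotonicity and non-degeneracy are three uses of `nonpos_of_wronskian_tendsto_zero`,
with a positive solution as `ψ` and with `w` a difference of solutions, `-U'`, or a bounded `φ`. In
each case `w'' ψ - w ψ''` is strictly positive where `w > 0`, because `u ↦ u^p` is increasing. Decay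
at `-∞` kills the Wronskian, and growth of `ψ` at `+∞` keeps `w` from dominating a multiple of it.
-/

/-! ### Maximum principles from the Wronskian -/

/-- Forward propagation for the ratio `w / ψ` on a compact interval: if `w'' ψ ≥ w ψ''` wherever
`w > 0`, and at the left endpoint `w > 0` and the Wronskian `w' ψ - w ψ'` is nonnegative, then `w`
stays positive and the ratio stays above its value at the left endpoint. -/
theorem ratio_forward {w w' w'' ψ ψ' ψ'' : ℝ → ℝ} {a b : ℝ}
    (hw : ∀ x ∈ Set.Icc a b, HasDerivAt w (w' x) x)
    (hw' : ∀ x ∈ Set.Icc a b, HasDerivAt w' (w'' x) x)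
    (hψ : ∀ x ∈ Set.Icc a b, HasDerivAt ψ (ψ' x) x)
    (hψ' : ∀ x ∈ Set.Icc a b, HasDerivAt ψ' (ψ'' x) x)
    (pos : ∀ x ∈ Set.Icc a b, 0 < ψ x)
    (key : ∀ x ∈ Set.Icc a b, 0 < w x → w x * ψ'' x ≤ w'' x * ψ x)
    (ha : 0 < w a) (hWa : 0 ≤ w' a * ψ a - w a * ψ' a) :
    ∀ x ∈ Set.Icc a b, 0 < w x ∧ w a / ψ a ≤ w x / ψ x := by
  have hW : ∀ x ∈ Set.Icc a b, HasDerivAt (fun x => w' x * ψ x - w x * ψ' x)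
      (w'' x * ψ x - w x * ψ'' x) x := by
    intro x hx
    have := ((hw' x hx).mul (hψ x hx)).sub ((hw x hx).mul (hψ' x hx))
    refine this.congr_deriv ?_
    ring
  have hr : ∀ x ∈ Set.Icc a b, HasDerivAt (fun x => w x / ψ x)
      ((w' x * ψ x - w x * ψ' x) / ψ x ^ 2) x := fun x hx =>
    (hw x hx).div (hψ x hx) (pos x hx).ne'
  -- Positivity is asked only before `c`, so that `c` may be the first point where `w ≤ 0`; the
  -- bound then contradicts `w c ≤ 0`.
  have aux : ∀ c ∈ Set.Icc a b, (∀ x ∈ Set.Ico a c, 0 < w x) → w a / ψ a ≤ w c / ψ c := by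
    intro c hc hpos
    have sub : Set.Icc a c ⊆ Set.Icc a b := Set.Icc_subset_Icc_right hc.2
    have mW : MonotoneOn (fun x => w' x * ψ x - w x * ψ' x) (Set.Icc a c) := by
      apply monotoneOn_of_deriv_nonneg (convex_Icc a c)
      · exact fun x hx => (hW x (sub hx)).continuousAt.continuousWithinAt
      · intro x hx
        exact (hW x (sub (interior_subset hx))).differentiableAt.differentiableWithinAt
      · intro x hx
        rw [(hW x (sub (interior_subset hx))).deriv]
        rw [interior_Icc] at hx
        have := key x (sub (Set.Ioo_subset_Icc_self hx)) (hpos x ⟨hx.1.le, hx.2⟩)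
        linarith
    have mr : MonotoneOn (fun x => w x / ψ x) (Set.Icc a c) := by
      apply monotoneOn_of_deriv_nonneg (convex_Icc a c)
      · exact fun x hx => (hr x (sub hx)).continuousAt.continuousWithinAt
      · intro x hx
        exact (hr x (sub (interior_subset hx))).differentiableAt.differentiableWithinAt
      · intro x hx
        have hx' := interior_subset hx
        rw [(hr x (sub hx')).deriv]
        have : w' a * ψ a - w a * ψ' a ≤ w' x * ψ x - w x * ψ' x :=
          mW ⟨le_rfl, hc.1⟩ hx' hx'.1
        have : 0 ≤ w' x * ψ x - w x * ψ' x := hWa.trans this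
        positivity
    exact mr ⟨le_rfl, hc.1⟩ ⟨hc.1, le_rfl⟩ hc.1
  have hpos : ∀ x ∈ Set.Icc a b, 0 < w x := by
    by_contra! hcon
    have hcont : ContinuousOn w (Set.Icc a b) := fun x hx =>
      (hw x hx).continuousAt.continuousWithinAt
    have hcomp : IsCompact (Set.Icc a b ∩ w ⁻¹' Set.Iic 0) :=
      isCompact_Icc.of_isClosed_subset (hcont.preimage_isClosed_of_isClosed isClosed_Icc isClosed_Iic)
        Set.inter_subset_left
    obtain ⟨x, hx, hx0⟩ := hcon
    obtain ⟨c, hc, hmin⟩ := hcomp.exists_isLeast ⟨x, hx, hx0⟩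
    have h1 := aux c hc.1 fun y hy => by
      by_contra! hy0
      exact absurd (hmin ⟨⟨hy.1, hy.2.le.trans hc.1.2⟩, hy0⟩) (not_le.2 hy.2)
    have h2 : 0 < w a / ψ a := div_pos ha (pos a ⟨le_rfl, hx.1.trans hx.2⟩)
    have h3 : w c / ψ c ≤ 0 := div_nonpos_of_nonpos_of_nonneg hc.2 (pos c hc.1).le
    linarith
  exact fun x hx => ⟨hpos x hx, aux x hx fun y hy => hpos y ⟨hy.1, hy.2.le.trans hx.2⟩⟩

/-- Backward propagation for the ratio `w / ψ`, the mirror image of `ratio_forward`. -/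
theorem ratio_backward {w w' w'' ψ ψ' ψ'' : ℝ → ℝ} {a b : ℝ}
    (hw : ∀ x ∈ Set.Icc a b, HasDerivAt w (w' x) x)
    (hw' : ∀ x ∈ Set.Icc a b, HasDerivAt w' (w'' x) x)
    (hψ : ∀ x ∈ Set.Icc a b, HasDerivAt ψ (ψ' x) x)
    (hψ' : ∀ x ∈ Set.Icc a b, HasDerivAt ψ' (ψ'' x) x)
    (pos : ∀ x ∈ Set.Icc a b, 0 < ψ x)
    (key : ∀ x ∈ Set.Icc a b, 0 < w x → w x * ψ'' x ≤ w'' x * ψ x)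
    (hb : 0 < w b) (hWb : w' b * ψ b - w b * ψ' b ≤ 0) :
    ∀ x ∈ Set.Icc a b, 0 < w x ∧ w b / ψ b ≤ w x / ψ x := by
  have neg_mem : ∀ x ∈ Set.Icc (-b) (-a), -x ∈ Set.Icc a b := fun x hx =>
    ⟨by linarith [hx.2], by linarith [hx.1]⟩
  have refl1 : ∀ {f f' : ℝ → ℝ}, (∀ x ∈ Set.Icc a b, HasDerivAt f (f' x) x) →
      ∀ x ∈ Set.Icc (-b) (-a), HasDerivAt (fun x => f (-x)) (-f' (-x)) x := by
    intro f f' h x hx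
    have := (h (-x) (neg_mem x hx)).comp x (hasDerivAt_neg x)
    exact this.congr_deriv (by ring)
  have refl2 : ∀ {f f' : ℝ → ℝ}, (∀ x ∈ Set.Icc a b, HasDerivAt f (f' x) x) →
      ∀ x ∈ Set.Icc (-b) (-a), HasDerivAt (fun x => -f (-x)) (f' (-x)) x := by
    intro f f' h x hx
    exact (refl1 h x hx).neg.congr_deriv (by ring)
  have := ratio_forward (refl1 hw) (refl2 hw') (refl1 hψ) (refl2 hψ')
    (fun x hx => pos _ (neg_mem x hx)) (fun x hx => key _ (neg_mem x hx))
    (by simpa using hb) (by simp only [neg_neg]; linarith)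
  intro x hx
  simpa using this (-x) ⟨by linarith [hx.2], by linarith [hx.1]⟩

/-- Maximum principle on the line: if `w'' ψ ≥ w ψ''` wherever `w > 0`, and `w / ψ` vanishes at both
ends, then `w ≤ 0`. -/
theorem nonpos_of_ratio_tendsto_zero {w w' w'' ψ ψ' ψ'' : ℝ → ℝ}
    (hw : ∀ x, HasDerivAt w (w' x) x) (hw' : ∀ x, HasDerivAt w' (w'' x) x)
    (hψ : ∀ x, HasDerivAt ψ (ψ' x) x) (hψ' : ∀ x, HasDerivAt ψ' (ψ'' x) x)
    (pos : ∀ x, 0 < ψ x) (key : ∀ x, 0 < w x → w x * ψ'' x ≤ w'' x * ψ x)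
    (hbot : Tendsto (fun x => w x / ψ x) atBot (𝓝 0))
    (htop : Tendsto (fun x => w x / ψ x) atTop (𝓝 0)) (x : ℝ) : w x ≤ 0 := by
  by_contra! hx
  have hr : 0 < w x / ψ x := div_pos hx (pos x)
  rcases le_total 0 (w' x * ψ x - w x * ψ' x) with h | h
  · refine absurd (ge_of_tendsto htop ?_) (not_le.2 hr)
    filter_upwards [eventually_ge_atTop x] with y hy
    exact (ratio_forward (fun x _ => hw x) (fun x _ => hw' x) (fun x _ => hψ x) (fun x _ => hψ' x)
      (fun x _ => pos x) (fun x _ => key x) hx h y ⟨hy, le_rfl⟩).2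
  · refine absurd (ge_of_tendsto hbot ?_) (not_le.2 hr)
    filter_upwards [eventually_le_atBot x] with y hy
    exact (ratio_backward (fun x _ => hw x) (fun x _ => hw' x) (fun x _ => hψ x) (fun x _ => hψ' x)
      (fun x _ => pos x) (fun x _ => key x) hx h y ⟨le_rfl, hy⟩).2

/-- Maximum principle on a half-line: if `w'' ≥ w` wherever `w > 0`, `w a ≤ 0` and `w = o(eˣ)`, then
`w ≤ 0` on `[a, ∞)`. -/
theorem nonpos_of_le_deriv2 {w w' w'' : ℝ → ℝ} {a : ℝ}
    (hw : ∀ x, a ≤ x → HasDerivAt w (w' x) x) (hw' : ∀ x, a ≤ x → HasDerivAt w' (w'' x) x)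
    (key : ∀ x, a ≤ x → 0 < w x → w x ≤ w'' x) (ha : w a ≤ 0)
    (htop : Tendsto (fun x => w x / Real.exp x) atTop (𝓝 0)) {x : ℝ} (hax : a ≤ x) : w x ≤ 0 := by
  by_contra! hx
  have hr : 0 < w x / Real.exp x := div_pos hx (Real.exp_pos x)
  have key' : ∀ x, a ≤ x → 0 < w x → w x * Real.exp x ≤ w'' x * Real.exp x := fun x h h' =>
    mul_le_mul_of_nonneg_right (key x h h') (Real.exp_pos x).le
  rcases le_total 0 (w' x * Real.exp x - w x * Real.exp x) with h | h
  · refine absurd (ge_of_tendsto htop ?_) (not_le.2 hr)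
    filter_upwards [eventually_ge_atTop x] with y hy
    exact (ratio_forward (fun z hz => hw z (hax.trans hz.1)) (fun z hz => hw' z (hax.trans hz.1))
      (fun z _ => Real.hasDerivAt_exp z) (fun z _ => Real.hasDerivAt_exp z)
      (fun z _ => Real.exp_pos z) (fun z hz => key' z (hax.trans hz.1)) hx h y ⟨hy, le_rfl⟩).2
  · have := (ratio_backward (fun z hz => hw z hz.1) (fun z hz => hw' z hz.1)
      (fun z _ => Real.hasDerivAt_exp z) (fun z _ => Real.hasDerivAt_exp z)
      (fun z _ => Real.exp_pos z) (fun z hz => key' z hz.1) hx h a ⟨le_rfl, hax⟩).1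
    linarith

/-- Maximum principle on the line with a Wronskian condition at `-∞`: if `w'' ψ > w ψ''` wherever
`w > 0`, the Wronskian `w' ψ - w ψ'` vanishes at `-∞`, and `w` does not dominate a positive multiple
of `ψ` near `+∞`, then `w ≤ 0`. -/
theorem nonpos_of_wronskian_tendsto_zero {w w' w'' ψ ψ' ψ'' : ℝ → ℝ}
    (hw : ∀ x, HasDerivAt w (w' x) x) (hw' : ∀ x, HasDerivAt w' (w'' x) x)
    (hψ : ∀ x, HasDerivAt ψ (ψ' x) x) (hψ' : ∀ x, HasDerivAt ψ' (ψ'' x) x)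
    (pos : ∀ x, 0 < ψ x) (key : ∀ x, 0 < w x → w x * ψ'' x < w'' x * ψ x)
    (hbot : Tendsto (fun x => w' x * ψ x - w x * ψ' x) atBot (𝓝 0))
    (htop : ∀ δ > 0, ¬ ∀ᶠ x in atTop, δ * ψ x ≤ w x) (x : ℝ) : w x ≤ 0 := by
  by_contra! hx
  have hr : 0 < w x / ψ x := div_pos hx (pos x)
  rcases le_total 0 (w' x * ψ x - w x * ψ' x) with h | h
  · refine htop _ hr ?_
    filter_upwards [eventually_ge_atTop x] with y hy
    rw [← le_div_iff₀ (pos y)]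
    exact (ratio_forward (fun x _ => hw x) (fun x _ => hw' x) (fun x _ => hψ x) (fun x _ => hψ' x)
      (fun x _ => pos x) (fun x _ h => (key x h).le) hx h y ⟨hy, le_rfl⟩).2
  · have hpos : ∀ y ≤ x, 0 < w y := fun y hy =>
      (ratio_backward (fun x _ => hw x) (fun x _ => hw' x) (fun x _ => hψ x) (fun x _ => hψ' x)
      (fun x _ => pos x) (fun x _ h => (key x h).le) hx h y ⟨le_rfl, hy⟩).1
    have hW : ∀ x, HasDerivAt (fun x => w' x * ψ x - w x * ψ' x)
        (w'' x * ψ x - w x * ψ'' x) x := fun x =>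
      (((hw' x).mul (hψ x)).sub ((hw x).mul (hψ' x))).congr_deriv (by ring)
    have mono : StrictMonoOn (fun x => w' x * ψ x - w x * ψ' x) (Set.Iic x) := by
      apply strictMonoOn_of_deriv_pos (convex_Iic x)
      · exact fun y _ => (hW y).continuousAt.continuousWithinAt
      · intro y hy
        have hy' : y ∈ Set.Iic x := interior_subset hy
        rw [(hW y).deriv]
        linarith [key y (hpos y hy')]
    -- The strictly increasing Wronskian has limit `0` at `-∞`, so it is nonnegative at `x - 1`;
    -- moving on to `x` makes it positive, against `h`.
    have h1 : w' (x - 1) * ψ (x - 1) - w (x - 1) * ψ' (x - 1) < w' x * ψ x - w x * ψ' x :=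
      mono (by simp) (by simp) (by linarith)
    have h2 : 0 ≤ w' (x - 1) * ψ (x - 1) - w (x - 1) * ψ' (x - 1) := by
      refine le_of_tendsto hbot ?_
      filter_upwards [eventually_le_atBot (x - 1)] with y hy
      exact mono.monotoneOn (Set.mem_Iic.2 (by linarith)) (by simp) hy
    linarith

/-! ### The linear problem with quadratic potential -/

theorem one_add_sq_pow_le_exp {a : ℝ} (ha : 0 < a) (n : ℕ) :
    ∃ C : ℝ, ∀ x : ℝ, (1 + x ^ 2) ^ n ≤ C * Real.exp (a * x ^ 2) := by
  refine ⟨n.factorial / a ^ n * Real.exp a, fun x => ?_⟩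
  have h := Real.pow_div_factorial_le_exp (a * (1 + x ^ 2)) (by positivity) n
  rw [mul_assoc, ← Real.exp_add]
  rw [show a + a * x ^ 2 = a * (1 + x ^ 2) by ring]
  rw [mul_pow, div_le_iff₀ (by positivity)] at h
  rw [div_mul_eq_mul_div, le_div_iff₀ (by positivity)]
  linarith

theorem integrable_of_le_one_add_sq_pow {a C : ℝ} (ha : 0 < a) (n : ℕ) {f : ℝ → ℝ}
    (hf : Continuous f) (hC : ∀ x, |f x| ≤ C * (1 + x ^ 2) ^ n * Real.exp (-(a * x ^ 2))) :
    MeasureTheory.Integrable f := by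
  obtain ⟨D, hD⟩ := one_add_sq_pow_le_exp (half_pos ha) n
  have hC0 : 0 ≤ C := by
    have h := (abs_nonneg _).trans (hC 0)
    simpa using h
  refine ((integrable_exp_neg_mul_sq (half_pos ha)).const_mul (C * D)).mono'
    hf.aestronglyMeasurable (Eventually.of_forall fun x => ?_)
  refine (hC x).trans ?_
  have h := mul_le_mul_of_nonneg_left (hD x) hC0
  refine (mul_le_mul_of_nonneg_right h (Real.exp_pos _).le).trans (le_of_eq ?_)
  rw [← mul_assoc, mul_assoc (C * D), ← Real.exp_add]
  ring_nf

theorem tendsto_div_exp_sq_zero {a C : ℝ} (ha : 0 < a) (n : ℕ) {f : ℝ → ℝ}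
    (hC : ∀ x, |f x| ≤ C * (1 + x ^ 2) ^ n) {l : Filter ℝ} (hl : Tendsto (fun x => x ^ 2) l atTop) :
    Tendsto (fun x => f x / Real.exp (a * x ^ 2)) l (𝓝 0) := by
  obtain ⟨D, hD⟩ := one_add_sq_pow_le_exp (half_pos ha) n
  have hC0 : 0 ≤ C := by
    have h := (abs_nonneg _).trans (hC 0)
    simpa using h
  have h0 : Tendsto (fun x : ℝ => C * D * Real.exp (-(a / 2 * x ^ 2))) l (𝓝 0) := by
    have := (Real.tendsto_exp_neg_atTop_nhds_zero.comp
      (hl.const_mul_atTop (half_pos ha))).const_mul (C * D)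
    simpa using this
  refine squeeze_zero_norm (fun x => ?_) h0
  rw [Real.norm_eq_abs, abs_div, abs_of_pos (Real.exp_pos _), div_le_iff₀ (Real.exp_pos _)]
  refine (hC x).trans ((mul_le_mul_of_nonneg_left (hD x) hC0).trans (le_of_eq ?_))
  rw [← mul_assoc, mul_assoc (C * D), ← Real.exp_add]
  ring_nf

/-- Solvability of `u'' = (A + A² x²) u - g` on the line, with `u = o(exp (A x² / 2))`. -/
theorem exists_linear_solution {A B : ℝ} (hA : 0 < A) {g : ℝ → ℝ} (hg : Continuous g)
    (hB : ∀ x, |g x| ≤ B * (1 + x ^ 2) ^ 2) :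
    ∃ u u' : ℝ → ℝ, (∀ x, HasDerivAt u (u' x) x) ∧
      (∀ x, HasDerivAt u' ((A + A ^ 2 * x ^ 2) * u x - g x) x) ∧
      Tendsto (fun x => u x / Real.exp (A / 2 * x ^ 2)) atBot (𝓝 0) ∧
      Tendsto (fun x => u x / Real.exp (A / 2 * x ^ 2)) atTop (𝓝 0) := by
  have hB0 : 0 ≤ B := by
    have h := (abs_nonneg _).trans (hB 0)
    simpa using h
  -- Reduction of order: `ψ'' = (A + A² x²) ψ`, so `u = ψ v` turns the equation into `(ψ² v')' = -ψ
  -- g`, that is `v' = (c - P) / ψ²`.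
  set ψ : ℝ → ℝ := fun x => Real.exp (A / 2 * x ^ 2) with hψdef
  have ψpos : ∀ x, 0 < ψ x := fun x => Real.exp_pos _
  have ψcont : Continuous ψ := by fun_prop
  have hψ : ∀ x, HasDerivAt ψ (A * x * ψ x) x := by
    intro x
    have := (((hasDerivAt_id x).pow 2).const_mul (A / 2)).exp
    refine this.congr_deriv ?_
    simp [hψdef]
    ring
  set P : ℝ → ℝ := fun x => ∫ y in (0 : ℝ)..x, ψ y * g y with hPdef
  have hP : ∀ x, HasDerivAt P (ψ x * g x) x := fun x =>
    ((ψcont.mul hg).integral_hasStrictDerivAt 0 x).hasDerivAt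
  have Pcont : Continuous P := continuous_iff_continuousAt.2 fun x => (hP x).continuousAt
  have hPb : ∀ x, |P x| ≤ B * (1 + x ^ 2) ^ 3 * ψ x := by
    intro x
    have h1 : ‖P x‖ ≤ (ψ x * (B * (1 + x ^ 2) ^ 2)) * |x - 0| := by
      refine intervalIntegral.norm_integral_le_of_norm_le_const fun y hy => ?_
      have hyx : y ^ 2 ≤ x ^ 2 := by
        rw [sq_le_sq]
        rcases Set.mem_uIoc.1 hy with h | h
        · rw [abs_of_pos h.1, abs_of_pos (h.1.trans_le h.2)]; exact h.2
        · rw [abs_of_nonpos h.2, abs_of_neg (h.1.trans_le h.2)]; linarith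
      rw [norm_mul, Real.norm_eq_abs, Real.norm_eq_abs, abs_of_pos (ψpos y)]
      have h2 : ψ y ≤ ψ x := Real.exp_le_exp.2 (by nlinarith)
      have h3 : |g y| ≤ B * (1 + x ^ 2) ^ 2 := (hB y).trans (by gcongr)
      exact mul_le_mul h2 h3 (abs_nonneg _) (ψpos x).le
    have h4 : |x - 0| ≤ 1 + x ^ 2 := by
      rw [sub_zero]; nlinarith [sq_nonneg (|x| - 1), sq_abs x]
    rw [Real.norm_eq_abs] at h1
    refine h1.trans ((mul_le_mul_of_nonneg_left h4 (by have := ψpos x; positivity)).trans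
      (le_of_eq (by ring)))
  have ψinv : ∀ x, (ψ x ^ 2)⁻¹ = Real.exp (-(A * x ^ 2)) := by
    intro x
    rw [hψdef]; simp only
    rw [← Real.exp_nat_mul, ← Real.exp_neg]; congr 1; push_cast; ring
  have int1 : MeasureTheory.Integrable (fun x => (ψ x ^ 2)⁻¹) := by
    simp_rw [ψinv]
    simpa using integrable_exp_neg_mul_sq hA
  have int2 : MeasureTheory.Integrable (fun x => (ψ x ^ 2)⁻¹ * P x) := by
    refine integrable_of_le_one_add_sq_pow (half_pos hA) 3 (C := B) ?_ fun x => ?_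
    · exact (Continuous.inv₀ (by fun_prop) fun x => (pow_pos (ψpos x) 2).ne').mul Pcont
    · rw [abs_mul, abs_of_pos (inv_pos.2 (pow_pos (ψpos x) 2))]
      refine (mul_le_mul_of_nonneg_left (hPb x) (inv_pos.2 (pow_pos (ψpos x) 2)).le).trans
        (le_of_eq ?_)
      rw [Real.exp_neg, show Real.exp (A / 2 * x ^ 2) = ψ x from rfl]
      field_simp [(ψpos x).ne']
  have Ipos : 0 < ∫ x, (ψ x ^ 2)⁻¹ := by
    simp_rw [ψinv]
    have := integral_gaussian A
    simp only [neg_mul] at this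
    rw [this]
    positivity
  -- The free constant is chosen so that `v'` has total integral zero; the primitive vanishing at
  -- `-∞` then vanishes at `+∞` too.
  set c : ℝ := (∫ x, (ψ x ^ 2)⁻¹ * P x) / ∫ x, (ψ x ^ 2)⁻¹ with hc
  set h : ℝ → ℝ := fun x => (ψ x ^ 2)⁻¹ * c - (ψ x ^ 2)⁻¹ * P x with hh
  have hint : MeasureTheory.Integrable h := (int1.mul_const c).sub int2
  have hcont : Continuous h := by
    have : Continuous fun x => (ψ x ^ 2)⁻¹ :=
      Continuous.inv₀ (by fun_prop) fun x => (pow_pos (ψpos x) 2).ne'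
    exact (this.mul continuous_const).sub (this.mul Pcont)
  have hzero : ∫ x, h x = 0 := by
    rw [hh, MeasureTheory.integral_sub (int1.mul_const c) int2, MeasureTheory.integral_mul_const, hc,
      mul_comm, div_mul_cancel₀ _ Ipos.ne', sub_self]
  set v : ℝ → ℝ := fun x => (∫ y in Set.Iic 0, h y) + ∫ y in (0 : ℝ)..x, h y with hv
  have hvd : ∀ x, HasDerivAt v (h x) x := fun x =>
    ((hcont.integral_hasStrictDerivAt 0 x).hasDerivAt).const_add _
  have vtop : Tendsto v atTop (𝓝 0) := by
    rw [← hzero, ← intervalIntegral.integral_Iic_add_Ioi (b := 0) hint.integrableOn hint.integrableOn]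
    exact (MeasureTheory.intervalIntegral_tendsto_integral_Ioi 0 hint.integrableOn
      tendsto_id).const_add _
  have vbot : Tendsto v atBot (𝓝 0) := by
    have := (MeasureTheory.intervalIntegral_tendsto_integral_Iic (0 : ℝ) hint.integrableOn
      (tendsto_id (α := ℝ) (x := atBot))).const_sub (∫ y in Set.Iic 0, h y)
    rw [sub_self] at this
    refine this.congr fun x => ?_
    simp only [hv, id]
    rw [intervalIntegral.integral_symm]
    ring
  refine ⟨fun x => ψ x * v x, fun x => A * x * ψ x * v x + (ψ x)⁻¹ * (c - P x), ?_, ?_, ?_, ?_⟩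
  · intro x
    refine ((hψ x).mul (hvd x)).congr_deriv ?_
    have := (ψpos x).ne'
    simp only [hh]
    field_simp
  · intro x
    have h1 := ((((hasDerivAt_id x).const_mul A).mul (hψ x)).mul (hvd x)).add
      (((hψ x).inv (ψpos x).ne').mul ((hP x).const_sub c))
    refine h1.congr_deriv ?_
    have := (ψpos x).ne'
    simp only [hh, id, Pi.mul_apply, Pi.inv_apply]
    field_simp
    ring
  · refine vbot.congr fun x => ?_
    exact (mul_div_cancel_left₀ _ (ψpos x).ne').symm
  · refine vtop.congr fun x => ?_
    have hne : ψ x ≠ 0 := (ψpos x).ne'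
    exact (mul_div_cancel_left₀ _ hne).symm

/-! ### Passage to the limit and comparison for the linear problem -/

/-- A pointwise limit of functions whose second derivatives are locally dominated and converge
pointwise to a function that is continuous as soon as the limit is. -/
theorem exists_hasDerivAt_of_pointwise_limit {u u' F : ℕ → ℝ → ℝ} {U G M : ℝ → ℝ}
    (hu : ∀ n x, HasDerivAt (u n) (u' n x) x) (hu' : ∀ n x, HasDerivAt (u' n) (F n x) x)
    (hF : ∀ n, Continuous (F n)) (hM : Continuous M) (hb : ∀ n x, |F n x| ≤ M x)
    (hU : ∀ x, Tendsto (fun n => u n x) atTop (𝓝 (U x)))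
    (hG : ∀ x, Tendsto (fun n => F n x) atTop (𝓝 (G x)))
    (hGc : Continuous U → Continuous G) :
    ∃ U' : ℝ → ℝ, (∀ x, HasDerivAt U (U' x) x) ∧ ∀ x, HasDerivAt U' (G x) x := by
  have hGm : Measurable G :=
    measurable_of_tendsto_metrizable (fun n => (hF n).measurable) (tendsto_pi_nhds.2 hG)
  have hGb : ∀ x, |G x| ≤ M x := fun x =>
    le_of_tendsto (hG x).abs (Eventually.of_forall fun n => hb n x)
  have hGi : ∀ a b, IntervalIntegrable G MeasureTheory.volume a b := fun a b =>
    (hM.intervalIntegrable a b).mono_fun hGm.aestronglyMeasurable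
      (Eventually.of_forall fun x => by
        simpa only [Real.norm_eq_abs] using (hGb x).trans (le_abs_self _))
  set Φ : ℝ → ℝ := fun x => ∫ y in (0 : ℝ)..x, G y with hΦ
  have hΦc : Continuous Φ := intervalIntegral.continuous_primitive hGi 0
  have hΦn : ∀ x, Tendsto (fun n => ∫ y in (0 : ℝ)..x, F n y) atTop (𝓝 (Φ x)) := fun x =>
    intervalIntegral.tendsto_integral_filter_of_dominated_convergence M
      (Eventually.of_forall fun n => (hF n).aestronglyMeasurable)
      (Eventually.of_forall fun n => Eventually.of_forall fun y _ => hb n y)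
      (hM.intervalIntegrable 0 x) (Eventually.of_forall fun y _ => hG y)
  have hFc : ∀ n, Continuous fun x => ∫ y in (0 : ℝ)..x, F n y := fun n =>
    intervalIntegral.continuous_primitive (fun a b => (hF n).intervalIntegrable a b) 0
  set N : ℝ → ℝ := fun x => |∫ y in (0 : ℝ)..x, M y| with hN
  have hNc : Continuous N :=
    (intervalIntegral.continuous_primitive (fun a b => hM.intervalIntegrable a b) 0).abs
  have hΦΦ : ∀ x, Tendsto (fun n => ∫ y in (0 : ℝ)..x, ∫ z in (0 : ℝ)..y, F n z) atTop
      (𝓝 (∫ y in (0 : ℝ)..x, Φ y)) := fun x =>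
    intervalIntegral.tendsto_integral_filter_of_dominated_convergence N
      (Eventually.of_forall fun n => (hFc n).aestronglyMeasurable)
      (Eventually.of_forall fun n => Eventually.of_forall fun y _ =>
        intervalIntegral.norm_integral_le_abs_of_norm_le
          (Eventually.of_forall fun z => hb n z) (hM.intervalIntegrable 0 y))
      (hNc.intervalIntegrable 0 x) (Eventually.of_forall fun y _ => hΦn y)
  have hrep' : ∀ n x, u' n x = u' n 0 + ∫ y in (0 : ℝ)..x, F n y := by
    intro n x
    rw [intervalIntegral.integral_eq_sub_of_hasDerivAt (fun y _ => hu' n y)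
      ((hF n).intervalIntegrable 0 x)]
    ring
  have hrep : ∀ n x, u n x = u n 0 + u' n 0 * x + ∫ y in (0 : ℝ)..x, ∫ z in (0 : ℝ)..y, F n z := by
    intro n x
    have hc : Continuous (u' n) := continuous_iff_continuousAt.2 fun x => (hu' n x).continuousAt
    have h1 := intervalIntegral.integral_eq_sub_of_hasDerivAt (fun y _ => hu n y)
      (hc.intervalIntegrable 0 x)
    have h2 : ∫ y in (0 : ℝ)..x, u' n y =
        ∫ y in (0 : ℝ)..x, (u' n 0 + ∫ z in (0 : ℝ)..y, F n z) := by
      congr 1; ext y; exact hrep' n y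
    rw [intervalIntegral.integral_add (by simp) ((hFc n).intervalIntegrable 0 x),
      intervalIntegral.integral_const] at h2
    simp only [sub_zero, smul_eq_mul] at h2
    linarith
  -- No convergence of derivatives is assumed: the slopes at `0` are recovered from the values at
  -- `0` and `1`, since the double integrals converge by domination.
  set s : ℝ := U 1 - U 0 - ∫ y in (0 : ℝ)..1, Φ y with hs
  have hsn : Tendsto (fun n => u' n 0) atTop (𝓝 s) := by
    refine (((hU 1).sub (hU 0)).sub (hΦΦ 1)).congr fun n => ?_
    rw [hrep n 1]; ring
  have hUrep : ∀ x, U x = U 0 + s * x + ∫ y in (0 : ℝ)..x, Φ y := fun x =>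
    tendsto_nhds_unique (hU x)
      ((((hU 0).add (hsn.mul_const x)).add (hΦΦ x)).congr fun n => (hrep n x).symm)
  have hUd : ∀ x, HasDerivAt U (s + Φ x) x := by
    intro x
    have h1 := ((((hasDerivAt_id x).const_mul s).const_add (U 0)).add
      (hΦc.integral_hasStrictDerivAt 0 x).hasDerivAt)
    have h2 : U = fun x => U 0 + s * x + ∫ y in (0 : ℝ)..x, Φ y := funext hUrep
    rw [h2]
    exact h1.congr_deriv (by simp)
  have hUc : Continuous U := continuous_iff_continuousAt.2 fun x => (hUd x).continuousAt
  exact ⟨fun x => s + Φ x, hUd, fun x =>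
    (((hGc hUc).integral_hasStrictDerivAt 0 x).hasDerivAt).const_add s⟩

/-- Comparison for `w'' ≥ (A + A² x²) w` on the line within the class `o(exp (A x² / 2))`. -/
theorem nonpos_of_gaussian_weight {A : ℝ} {w w' w'' : ℝ → ℝ}
    (hw : ∀ x, HasDerivAt w (w' x) x) (hw' : ∀ x, HasDerivAt w' (w'' x) x)
    (key : ∀ x, (A + A ^ 2 * x ^ 2) * w x ≤ w'' x)
    (hbot : Tendsto (fun x => w x / Real.exp (A / 2 * x ^ 2)) atBot (𝓝 0))
    (htop : Tendsto (fun x => w x / Real.exp (A / 2 * x ^ 2)) atTop (𝓝 0)) (x : ℝ) : w x ≤ 0 := by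
  have hψ : ∀ x : ℝ, HasDerivAt (fun x => Real.exp (A / 2 * x ^ 2))
      (A * x * Real.exp (A / 2 * x ^ 2)) x := by
    intro x
    refine (((hasDerivAt_id x).pow 2).const_mul (A / 2)).exp.congr_deriv ?_
    simp
    ring
  have hψ' : ∀ x : ℝ, HasDerivAt (fun x => A * x * Real.exp (A / 2 * x ^ 2))
      ((A + A ^ 2 * x ^ 2) * Real.exp (A / 2 * x ^ 2)) x := by
    intro x
    refine (((hasDerivAt_id x).const_mul A).mul (hψ x)).congr_deriv ?_
    simp
    ring
  refine nonpos_of_ratio_tendsto_zero hw hw' hψ hψ' (fun x => Real.exp_pos _) (fun x _ => ?_)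
    hbot htop x
  rw [← mul_assoc]
  refine mul_le_mul_of_nonneg_right ?_ (Real.exp_pos _).le
  linarith [key x]

/-! ### Barriers -/

/-- The global supersolution `2 (1 + x²)^(1/(2p))`. -/
noncomputable def upperBarrier (p x : ℝ) : ℝ := 2 * (1 + x ^ 2) ^ (1 / (2 * p))

/-- The subsolutions `(c - 2)^(1/p) exp (-(x - c)² / 2)`, `c ≥ 2`. -/
noncomputable def lowerBarrier (p c x : ℝ) : ℝ :=
  (c - 2) ^ (1 / p) * Real.exp (-((x - c) ^ 2 / 2))

theorem upperBarrier_pos (p x : ℝ) : 0 < upperBarrier p x := by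
  unfold upperBarrier; positivity

theorem upperBarrier_continuous (p : ℝ) : Continuous (upperBarrier p) := by
  unfold upperBarrier
  exact continuous_const.mul (Continuous.rpow_const (by fun_prop) fun x =>
    Or.inl (by positivity))

theorem upperBarrier_le {p : ℝ} (hp : 1 < p) (x : ℝ) : upperBarrier p x ≤ 2 * (1 + x ^ 2) := by
  unfold upperBarrier
  have : (1 + x ^ 2) ^ (1 / (2 * p)) ≤ (1 + x ^ 2) ^ (1 : ℝ) :=
    Real.rpow_le_rpow_of_exponent_le (by nlinarith [sq_nonneg x])
      (by rw [div_le_one (by linarith)]; linarith)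
  rw [Real.rpow_one] at this
  linarith

theorem upperBarrier_rpow {p : ℝ} (hp : 1 < p) (x : ℝ) :
    upperBarrier p x ^ p = 2 ^ p * √(1 + x ^ 2) := by
  unfold upperBarrier
  rw [Real.mul_rpow (by norm_num) (by positivity), ← Real.rpow_mul (by positivity),
    Real.sqrt_eq_rpow]
  congr 2
  field_simp

/-- Both sides are compared with the barrier `B` itself: `B'' ≤ B` because the exponent lies in `(0,
1/2]`, and `B^p - x ≥ 2 √(1 + x²) - x ≥ 1`. -/
theorem upperBarrier_deriv {p : ℝ} (hp : 1 < p) :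
    ∃ u' u'' : ℝ → ℝ, (∀ x, HasDerivAt (upperBarrier p) (u' x) x) ∧
      (∀ x, HasDerivAt u' (u'' x) x) ∧
      ∀ x, u'' x ≤ upperBarrier p x * (upperBarrier p x ^ p - x) := by
  set a : ℝ := 1 / (2 * p) with ha
  have ha0 : 0 < a := by positivity
  have ha1 : a ≤ 1 / 2 := by
    rw [ha]; exact one_div_le_one_div_of_le (by norm_num) (by linarith)
  have hb : ∀ x : ℝ, HasDerivAt (fun x : ℝ => 1 + x ^ 2) (2 * x) x := by
    intro x
    exact (((hasDerivAt_id x).pow 2).const_add 1).congr_deriv (by simp)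
  have hpos : ∀ x : ℝ, 0 < 1 + x ^ 2 := fun x => by positivity
  refine ⟨fun x => 2 * (2 * x * a * (1 + x ^ 2) ^ (a - 1)),
    fun x => 2 * (2 * a * (1 + x ^ 2) ^ (a - 1)
      + 2 * x * a * (2 * x * (a - 1) * (1 + x ^ 2) ^ (a - 1 - 1))), fun x => ?_, fun x => ?_,
    fun x => ?_⟩
  · exact ((hb x).rpow_const (Or.inl (hpos x).ne')).const_mul 2
  · refine (((((hasDerivAt_id x).const_mul 2).mul_const a).mul
      ((hb x).rpow_const (p := a - 1) (Or.inl (hpos x).ne'))).const_mul 2).congr_deriv ?_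
    simp
  · have h1 : 2 * (2 * a * (1 + x ^ 2) ^ (a - 1)
      + 2 * x * a * (2 * x * (a - 1) * (1 + x ^ 2) ^ (a - 1 - 1))) ≤ upperBarrier p x := by
      have e1 : (1 + x ^ 2) ^ (a - 1) ≤ (1 + x ^ 2) ^ a :=
        Real.rpow_le_rpow_of_exponent_le (by nlinarith [sq_nonneg x]) (by linarith)
      have e2 : 0 < (1 + x ^ 2) ^ (a - 1) := Real.rpow_pos_of_pos (hpos x) _
      have e3 : 0 < (1 + x ^ 2) ^ (a - 1 - 1) := Real.rpow_pos_of_pos (hpos x) _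
      have e4 : 0 ≤ x ^ 2 * a * ((1 - a) * (1 + x ^ 2) ^ (a - 1 - 1)) := by
        have : 0 < 1 - a := by linarith
        positivity
      unfold upperBarrier
      rw [← ha]
      nlinarith
    refine h1.trans ?_
    have h2 : 1 ≤ upperBarrier p x ^ p - x := by
      rw [upperBarrier_rpow hp]
      have e1 : (2 : ℝ) ≤ 2 ^ p := by
        simpa using Real.rpow_le_rpow_of_exponent_le (x := 2) (by norm_num) hp.le
      have e2 : 1 ≤ √(1 + x ^ 2) := by
        rw [Real.one_le_sqrt]; nlinarith [sq_nonneg x]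
      have e3 : x ≤ √(1 + x ^ 2) := Real.le_sqrt_of_sq_le (by linarith)
      nlinarith
    nlinarith [upperBarrier_pos p x]

theorem lowerBarrier_nonneg {p c : ℝ} (hc : 2 ≤ c) (x : ℝ) : 0 ≤ lowerBarrier p c x :=
  mul_nonneg (Real.rpow_nonneg (by linarith) _) (Real.exp_pos _).le

theorem lowerBarrier_le_rpow {p c : ℝ} (hc : 2 ≤ c) (x : ℝ) :
    lowerBarrier p c x ≤ (c - 2) ^ (1 / p) :=
  mul_le_of_le_one_right (Real.rpow_nonneg (by linarith) _)
    (Real.exp_le_one_iff.2 (by nlinarith [sq_nonneg (x - c)]))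

/-- As `E ≤ E^(1/p)` for the Gaussian factor `E ≤ 1`, it suffices to compare `p`-th powers; there `c
≤ |x| + |x - c|` and `|x - c| E ≤ 1` give `(c - 2) E ≤ 2 √(1 + x²)`. -/
theorem lowerBarrier_le_upperBarrier {p c : ℝ} (hp : 1 < p) (hc : 2 ≤ c) (x : ℝ) :
    lowerBarrier p c x ≤ upperBarrier p x := by
  unfold lowerBarrier upperBarrier
  set E := Real.exp (-((x - c) ^ 2 / 2)) with hE
  have E0 : 0 < E := Real.exp_pos _
  have E1 : E ≤ 1 := Real.exp_le_one_iff.2 (by nlinarith [sq_nonneg (x - c)])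
  have hp1 : 1 / p ≤ 1 := by rw [div_le_one (by linarith)]; linarith
  have hp0 : 0 < 1 / p := by positivity
  have h1 : E ≤ E ^ (1 / p) := by
    simpa using Real.rpow_le_rpow_of_exponent_ge E0 E1 hp1
  have h2 : |x - c| * E ≤ 1 := by
    rw [hE, Real.exp_neg, ← div_eq_mul_inv, div_le_one (Real.exp_pos _)]
    have := Real.add_one_le_exp ((x - c) ^ 2 / 2)
    nlinarith [sq_nonneg (|x - c| - 1), sq_abs (x - c)]
  have h3 : (c - 2) * E ≤ 2 * √(1 + x ^ 2) := by
    have e1 : c ≤ |x| + |x - c| := by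
      have := neg_abs_le (x - c); have := le_abs_self x; linarith
    have e2 : 1 ≤ √(1 + x ^ 2) := by
      rw [Real.one_le_sqrt]; nlinarith [sq_nonneg x]
    have e3 : |x| ≤ √(1 + x ^ 2) := Real.abs_le_sqrt (by linarith)
    have e4 : (c - 2) * E ≤ (|x| + |x - c|) * E := by gcongr; linarith
    have e5 : |x| * E ≤ |x| := mul_le_of_le_one_right (abs_nonneg x) E1
    linarith
  calc (c - 2) ^ (1 / p) * E ≤ (c - 2) ^ (1 / p) * E ^ (1 / p) := by
        gcongr
    _ = ((c - 2) * E) ^ (1 / p) := (Real.mul_rpow (by linarith) E0.le).symm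
    _ ≤ (2 * √(1 + x ^ 2)) ^ (1 / p) :=
        Real.rpow_le_rpow (mul_nonneg (by linarith) E0.le) h3 hp0.le
    _ = 2 ^ (1 / p) * (1 + x ^ 2) ^ (1 / (2 * p)) := by
        rw [Real.mul_rpow (by norm_num) (Real.sqrt_nonneg _), Real.sqrt_eq_rpow,
          ← Real.rpow_mul (by positivity)]
        congr 2
        field_simp
    _ ≤ 2 * (1 + x ^ 2) ^ (1 / (2 * p)) := by
        gcongr
        simpa using Real.rpow_le_rpow_of_exponent_le (x := 2) (by norm_num) hp1

/-- With `y = x - c`, the Gaussian `m` has `m'' = (y² - 1) m` and `m^p ≤ c - 2`, so the claim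
reduces to `y² + y + 1 ≥ 0`. This is what the shift by `2` in the amplitude pays for. -/
theorem lowerBarrier_deriv {p c : ℝ} (hp : 1 < p) (hc : 2 ≤ c) :
    ∃ u' u'' : ℝ → ℝ, (∀ x, HasDerivAt (lowerBarrier p c) (u' x) x) ∧
      (∀ x, HasDerivAt u' (u'' x) x) ∧
      ∀ x, lowerBarrier p c x * (lowerBarrier p c x ^ p - x) ≤ u'' x := by
  have h1 : ∀ x, HasDerivAt (lowerBarrier p c) (-(x - c) * lowerBarrier p c x) x := by
    intro x
    have := ((((hasDerivAt_id x).sub_const c).pow 2).div_const 2).neg.exp.const_mul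
      ((c - 2) ^ (1 / p))
    refine this.congr_deriv ?_
    simp [lowerBarrier]
    ring
  refine ⟨_, fun x => ((x - c) ^ 2 - 1) * lowerBarrier p c x, h1, fun x => ?_, fun x => ?_⟩
  · refine ((((hasDerivAt_id x).sub_const c).neg).mul (h1 x)).congr_deriv ?_
    simp
    ring
  · rw [mul_comm]
    refine mul_le_mul_of_nonneg_right ?_ (lowerBarrier_nonneg hc x)
    have h2 : lowerBarrier p c x ^ p ≤ c - 2 := by
      have := Real.rpow_le_rpow (lowerBarrier_nonneg (p := p) hc x) (lowerBarrier_le_rpow hc x)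
        (by linarith : 0 ≤ p)
      rwa [← Real.rpow_mul (by linarith), one_div_mul_cancel (by linarith), Real.rpow_one] at this
    nlinarith [sq_nonneg (x - c + 1 / 2)]

/-! ### Monotone iteration -/

/-- Tangent-line inequality for the convex function `t^(p+1)`, obtained from Bernoulli's inequality
at `s / t`. -/
theorem rpow_mul_sub_le {p s t : ℝ} (hp : 1 < p) (hs : 0 ≤ s) (hst : s ≤ t) :
    t * t ^ p - s * s ^ p ≤ (p + 1) * t ^ p * (t - s) := by
  rcases (hs.trans hst).eq_or_lt with h | ht
  · have hs0 : s = 0 := le_antisymm (h ▸ hst) hs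
    rw [hs0, ← h]; simp
  have h1 := one_add_mul_self_le_rpow_one_add (s := s / t - 1) (p := p + 1)
    (by linarith [div_nonneg hs ht.le]) (by linarith)
  rw [show 1 + (s / t - 1) = s / t by ring, Real.div_rpow hs ht.le,
    le_div_iff₀ (Real.rpow_pos_of_pos ht _), Real.rpow_add_one ht.ne',
    Real.rpow_add_one' hs (by linarith)] at h1
  have h2 : (1 + (p + 1) * (s / t - 1)) * (t ^ p * t) = t ^ p * t + (p + 1) * t ^ p * (s - t) := by
    field_simp
  linarith

/-- The slope `(p + 1) 2^p + 1` in the weight `A + A² x²` of the monotone iteration. -/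
noncomputable def iterationSlope (p : ℝ) : ℝ := (p + 1) * 2 ^ p + 1

/-- The right-hand side of the monotone iteration. -/
noncomputable def iterationRhs (p x s : ℝ) : ℝ :=
  (iterationSlope p + iterationSlope p ^ 2 * x ^ 2) * s - s * (s ^ p - x)

theorem one_lt_iterationSlope {p : ℝ} (hp : 1 < p) : 1 < iterationSlope p := by
  unfold iterationSlope
  have : 0 < (p + 1) * (2 : ℝ) ^ p := by positivity
  linarith

theorem iterationRhs_mono {p x s t : ℝ} (hp : 1 < p) (hs : 0 ≤ s) (hst : s ≤ t)
    (ht : t ≤ upperBarrier p x) : iterationRhs p x s ≤ iterationRhs p x t := by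
  have h1 := rpow_mul_sub_le hp hs hst
  have h2 : t ^ p ≤ 2 ^ p * √(1 + x ^ 2) := by
    rw [← upperBarrier_rpow hp]
    exact Real.rpow_le_rpow (hs.trans hst) ht (by linarith)
  -- Below the upper barrier, `(p + 1) t^p - x ≤ A √(1 + x²) ≤ A + A² x²` with `A = iterationSlope
  -- p`; the summand `1` in `A` absorbs `-x`.
  have h3 : (p + 1) * t ^ p ≤ iterationSlope p + iterationSlope p ^ 2 * x ^ 2 + x := by
    have hA := one_lt_iterationSlope hp
    have e2 : √(1 + x ^ 2) ≤ 1 + x ^ 2 := by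
      rw [Real.sqrt_le_left (by positivity)]; nlinarith [sq_nonneg x]
    have e3 : -x ≤ √(1 + x ^ 2) := Real.le_sqrt_of_sq_le (by nlinarith)
    have e4 : (p + 1) * t ^ p ≤ (p + 1) * (2 ^ p * √(1 + x ^ 2)) := by gcongr
    have e5 : (p + 1) * (2 ^ p * √(1 + x ^ 2)) = (iterationSlope p - 1) * √(1 + x ^ 2) := by
      unfold iterationSlope; ring
    have e6 : iterationSlope p * √(1 + x ^ 2) ≤ iterationSlope p * (1 + x ^ 2) := by gcongr
    have e7 : iterationSlope p * x ^ 2 ≤ iterationSlope p ^ 2 * x ^ 2 := by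
      gcongr; nlinarith
    nlinarith
  have h4 := mul_le_mul_of_nonneg_right h3 (sub_nonneg.2 hst)
  unfold iterationRhs
  nlinarith

theorem abs_iterationRhs_le {p x s : ℝ} (hp : 1 < p) (hs : 0 ≤ s) (ht : s ≤ upperBarrier p x) :
    |iterationRhs p x s| ≤
      2 * (iterationSlope p + iterationSlope p ^ 2 + 1) * (1 + x ^ 2) ^ 2 := by
  have h0 : 0 ≤ iterationRhs p x s := by
    have := iterationRhs_mono hp le_rfl hs ht
    simpa [iterationRhs] using this
  rw [abs_of_nonneg h0]
  have hA := one_lt_iterationSlope hp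
  set A := iterationSlope p with hAdef
  have h1 : iterationRhs p x s ≤ (A + A ^ 2 * x ^ 2 + x) * s := by
    have : 0 ≤ s * s ^ p := mul_nonneg hs (Real.rpow_nonneg hs p)
    unfold iterationRhs
    nlinarith
  have h2 : A + A ^ 2 * x ^ 2 + x ≤ (A + A ^ 2 + 1) * (1 + x ^ 2) := by
    nlinarith [sq_nonneg (x - 1), mul_nonneg (by linarith : (0 : ℝ) ≤ A) (sq_nonneg x), sq_nonneg A]
  calc iterationRhs p x s ≤ (A + A ^ 2 * x ^ 2 + x) * s := h1
    _ ≤ ((A + A ^ 2 + 1) * (1 + x ^ 2)) * s := by gcongr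
    _ ≤ ((A + A ^ 2 + 1) * (1 + x ^ 2)) * (2 * (1 + x ^ 2)) := by
        gcongr; exact ht.trans (upperBarrier_le hp x)
    _ = _ := by ring

/-- Supersolutions between the barriers. -/
structure IsIterate (p : ℝ) (u : ℝ → ℝ) : Prop where
  lower : ∀ c, 2 ≤ c → ∀ x, lowerBarrier p c x ≤ u x
  upper : ∀ x, u x ≤ upperBarrier p x
  super : ∃ u' u'' : ℝ → ℝ, (∀ x, HasDerivAt u (u' x) x) ∧ (∀ x, HasDerivAt u' (u'' x) x) ∧
    ∀ x, u'' x ≤ u x * (u x ^ p - x)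

theorem IsIterate.nonneg {p : ℝ} {u : ℝ → ℝ} (h : IsIterate p u) (x : ℝ) : 0 ≤ u x :=
  (lowerBarrier_nonneg le_rfl x).trans (h.lower 2 le_rfl x)

theorem IsIterate.continuous {p : ℝ} {u : ℝ → ℝ} (h : IsIterate p u) : Continuous u := by
  obtain ⟨u', _, hu, _⟩ := h.super
  exact continuous_iff_continuousAt.2 fun x => (hu x).continuousAt

theorem isIterate_upperBarrier {p : ℝ} (hp : 1 < p) : IsIterate p (upperBarrier p) :=
  ⟨fun _ hc x => lowerBarrier_le_upperBarrier hp hc x, fun _ => le_rfl, upperBarrier_deriv hp⟩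

theorem continuous_iterationRhs {p : ℝ} (hp : 1 < p) {u : ℝ → ℝ} (hu : Continuous u) :
    Continuous fun x => iterationRhs p x (u x) := by
  have : Continuous fun x => u x ^ p := hu.rpow_const fun x => Or.inr (by linarith)
  unfold iterationRhs
  fun_prop

/-- Write `q = A + A² x²` and `f` for `iterationRhs`, and solve `v'' = q v - f(u)`. The
supersolution `u` has `u'' ≤ q u - f(u)`, so `v ≤ u`. A lower barrier `m` has `m'' ≥ q m - f(m) ≥ q
m - f(u)`, so `m ≤ v`. Finally `f(v) ≤ f(u)` makes `v` a supersolution again. -/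
theorem IsIterate.exists_next {p : ℝ} (hp : 1 < p) {u : ℝ → ℝ} (h : IsIterate p u) :
    ∃ v : ℝ → ℝ, IsIterate p v ∧ (∀ x, v x ≤ u x) ∧ ∃ v' : ℝ → ℝ,
      (∀ x, HasDerivAt v (v' x) x) ∧ ∀ x, HasDerivAt v'
        ((iterationSlope p + iterationSlope p ^ 2 * x ^ 2) * v x - iterationRhs p x (u x)) x := by
  have hA : 0 < iterationSlope p := by linarith [one_lt_iterationSlope hp]
  obtain ⟨v, v', hv, hv', vbot, vtop⟩ := exists_linear_solution hA
    (continuous_iterationRhs hp h.continuous)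
    fun x => abs_iterationRhs_le hp (h.nonneg x) (h.upper x)
  have sqbot : Tendsto (fun x : ℝ => x ^ 2) atBot atTop := by
    have := (tendsto_pow_atTop (α := ℝ) two_ne_zero).comp tendsto_neg_atBot_atTop
    exact this.congr fun x => by simp
  have sqtop : Tendsto (fun x : ℝ => x ^ 2) atTop atTop := tendsto_pow_atTop two_ne_zero
  have small : ∀ {f : ℝ → ℝ}, (∀ x, 0 ≤ f x) → (∀ x, f x ≤ upperBarrier p x) → ∀ {l : Filter ℝ},
      Tendsto (fun x : ℝ => x ^ 2) l atTop →
      Tendsto (fun x => f x / Real.exp (iterationSlope p / 2 * x ^ 2)) l (𝓝 0) := by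
    intro f h0 h1 l hl
    refine tendsto_div_exp_sq_zero (half_pos hA) 1 (C := 2) (fun x => ?_) hl
    rw [abs_of_nonneg (h0 x), pow_one]
    exact (h1 x).trans (upperBarrier_le hp x)
  obtain ⟨u', u'', hu, hu', hsup⟩ := h.super
  have hvu : ∀ x, v x ≤ u x := by
    intro x
    refine sub_nonpos.1 (nonpos_of_gaussian_weight (A := iterationSlope p) (fun x => (hv x).sub (hu x))
      (fun x => (hv' x).sub (hu' x)) (fun x => ?_) ?_ ?_ x)
    · have := hsup x
      simp only [iterationRhs, Pi.sub_apply]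
      linarith
    · simpa [sub_div] using vbot.sub (small h.nonneg h.upper sqbot)
    · simpa [sub_div] using vtop.sub (small h.nonneg h.upper sqtop)
  have hlow : ∀ c, 2 ≤ c → ∀ x, lowerBarrier p c x ≤ v x := by
    intro c hc x
    obtain ⟨m', m'', hm, hm', hsub⟩ := lowerBarrier_deriv hp hc
    have hle := lowerBarrier_le_upperBarrier hp hc
    refine sub_nonpos.1 (nonpos_of_gaussian_weight (A := iterationSlope p) (fun x => (hm x).sub (hv x))
      (fun x => (hm' x).sub (hv' x)) (fun x => ?_) ?_ ?_ x)
    · have h1 := hsub x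
      have h2 := iterationRhs_mono hp (lowerBarrier_nonneg hc x) (h.lower c hc x) (h.upper x)
      simp only [Pi.sub_apply]
      rw [iterationRhs] at h2
      linarith
    · simpa [sub_div] using (small (lowerBarrier_nonneg hc) hle sqbot).sub vbot
    · simpa [sub_div] using (small (lowerBarrier_nonneg hc) hle sqtop).sub vtop
  refine ⟨v, ⟨hlow, fun x => (hvu x).trans (h.upper x), v', _, hv, hv', fun x => ?_⟩, hvu, v',
    hv, hv'⟩
  have h0 : 0 ≤ v x := (lowerBarrier_nonneg le_rfl x).trans (hlow 2 le_rfl x)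
  have := iterationRhs_mono hp h0 (hvu x) (h.upper x)
  rw [iterationRhs] at this
  linarith

/-- Existence of a solution between the barriers. -/
theorem exists_solution_between_barriers {p : ℝ} (hp : 1 < p) :
    ∃ U U' : ℝ → ℝ, (∀ x, HasDerivAt U (U' x) x) ∧
      (∀ x, HasDerivAt U' (U x * (U x ^ p - x)) x) ∧ (∀ x, 0 ≤ U x) ∧
      (∀ x, U x ≤ upperBarrier p x) ∧ ∀ x, 2 ≤ x → (x - 2) ^ (1 / p) ≤ U x := by
  have hnext : ∀ u : {u // IsIterate p u}, ∃ v : {v // IsIterate p v}, (∀ x, v.1 x ≤ u.1 x) ∧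
      ∃ v' : ℝ → ℝ, (∀ x, HasDerivAt v.1 (v' x) x) ∧ ∀ x, HasDerivAt v'
        ((iterationSlope p + iterationSlope p ^ 2 * x ^ 2) * v.1 x
          - iterationRhs p x (u.1 x)) x := by
    rintro ⟨u, hu⟩
    obtain ⟨v, hv, h⟩ := hu.exists_next hp
    exact ⟨⟨v, hv⟩, h⟩
  choose next hle next' hd hd' using hnext
  set s : ℕ → {u // IsIterate p u} := fun n => next^[n] ⟨_, isIterate_upperBarrier hp⟩ with hs
  have hsucc : ∀ n, s (n + 1) = next (s n) := fun n => Function.iterate_succ_apply' _ _ _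
  have hanti : ∀ x, Antitone fun n => (s n).1 x := fun x => antitone_nat_of_succ_le fun n => by
    rw [hsucc]; exact hle _ x
  set U : ℝ → ℝ := fun x => ⨅ n, (s n).1 x with hU
  have hlim : ∀ x, Tendsto (fun n => (s n).1 x) atTop (𝓝 (U x)) := fun x =>
    tendsto_atTop_ciInf (hanti x) ⟨0, by rintro _ ⟨n, rfl⟩; exact (s n).2.nonneg x⟩
  have hlow : ∀ c, 2 ≤ c → ∀ x, lowerBarrier p c x ≤ U x := fun c hc x =>
    ge_of_tendsto' (hlim x) fun n => (s n).2.lower c hc x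
  have hup : ∀ x, U x ≤ upperBarrier p x := fun x => le_of_tendsto' (hlim x) fun n => (s n).2.upper x
  have hU0 : ∀ x, 0 ≤ U x := fun x => (lowerBarrier_nonneg le_rfl x).trans (hlow 2 le_rfl x)
  have hA : 0 < iterationSlope p := by linarith [one_lt_iterationSlope hp]
  obtain ⟨U', h1, h2⟩ := exists_hasDerivAt_of_pointwise_limit (u := fun n => (next (s n)).1)
    (u' := fun n => next' (s n)) (U := U) (G := fun x => U x * (U x ^ p - x))
    (M := fun x => (iterationSlope p + iterationSlope p ^ 2 * x ^ 2) * upperBarrier p x +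
      2 * (iterationSlope p + iterationSlope p ^ 2 + 1) * (1 + x ^ 2) ^ 2)
    (fun n => hd (s n)) (fun n => hd' (s n))
    (fun n => by
      have := continuous_iterationRhs hp (s n).2.continuous
      have := (next (s n)).2.continuous
      fun_prop)
    (by have := upperBarrier_continuous p; fun_prop)
    (fun n x => by
      refine (abs_sub _ _).trans ?_
      refine add_le_add ?_ (abs_iterationRhs_le hp ((s n).2.nonneg x) ((s n).2.upper x))
      rw [abs_of_nonneg (mul_nonneg (by positivity) ((next (s n)).2.nonneg x))]
      gcongr
      exact (next (s n)).2.upper x)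
    (fun x => by simpa only [hsucc] using (tendsto_add_atTop_iff_nat 1).2 (hlim x))
    (fun x => by
      have e1 : Tendsto (fun n => (next (s n)).1 x) atTop (𝓝 (U x)) := by
        simpa only [hsucc] using (tendsto_add_atTop_iff_nat 1).2 (hlim x)
      have e2 : Tendsto (fun n => (s n).1 x ^ p) atTop (𝓝 (U x ^ p)) :=
        (hlim x).rpow_const (Or.inr (by linarith))
      have e3 := (e1.const_mul (iterationSlope p + iterationSlope p ^ 2 * x ^ 2)).sub
        (((hlim x).const_mul (iterationSlope p + iterationSlope p ^ 2 * x ^ 2)).sub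
          ((hlim x).mul (e2.sub_const x)))
      rwa [sub_sub_cancel] at e3)
    (fun hc => by
      have : Continuous fun x => U x ^ p := hc.rpow_const fun x => Or.inr (by linarith)
      fun_prop)
  refine ⟨U, U', h1, h2, hU0, hup, fun x hx => ?_⟩
  -- Each point is taken as the centre of its own barrier, where the Gaussian factor is `1`.
  simpa [lowerBarrier] using hlow x hx x

/-! ### Airy-type decay at `-∞` -/

/-- Phase of the decaying barrier at `-∞`. -/
noncomputable def airyPhase (t : ℝ) : ℝ := 2 / 3 * t ^ (3 / 2 : ℝ) + Real.log t / 4 + t⁻¹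

/-- Derivative of `airyPhase`. -/
noncomputable def airyPhaseDeriv (t : ℝ) : ℝ := √t + t⁻¹ / 4 - (t ^ 2)⁻¹

theorem hasDerivAt_airyPhase {t : ℝ} (ht : 1 ≤ t) :
    HasDerivAt airyPhase (airyPhaseDeriv t) t := by
  have h0 : t ≠ 0 := by positivity
  have h1 := (((Real.hasDerivAt_rpow_const (x := t) (p := 3 / 2) (Or.inl h0)).const_mul (2 / 3)).add
    ((Real.hasDerivAt_log h0).div_const 4)).add (hasDerivAt_inv h0)
  refine h1.congr_deriv ?_
  rw [airyPhaseDeriv, Real.sqrt_eq_rpow]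
  norm_num
  ring

theorem hasDerivAt_airyPhaseDeriv {t : ℝ} (ht : 1 ≤ t) :
    HasDerivAt airyPhaseDeriv (1 / (2 * √t) - (t ^ 2)⁻¹ / 4 + 2 * (t ^ 3)⁻¹) t := by
  have h0 : t ≠ 0 := by positivity
  have h1 := ((Real.hasDerivAt_sqrt h0).add ((hasDerivAt_inv h0).div_const 4)).sub
    (((hasDerivAt_id t).pow 2).inv (pow_ne_zero 2 h0))
  refine h1.congr_deriv ?_
  simp
  field_simp
  ring

/-- Makes `b = exp (-airyPhase t)` satisfy `b'' ≤ t b`. The plain Airy profile gives `t + 5 / (16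
t²)`, slightly too much; the extra `t⁻¹` in the phase contributes `-2 t^(-3/2)`, which outweighs the
excess, while `exp (-t⁻¹) ≤ 1` leaves the decay bound intact. -/
theorem airyPhase_riccati {t : ℝ} (ht : 1 ≤ t) :
    airyPhaseDeriv t ^ 2 - (1 / (2 * √t) - (t ^ 2)⁻¹ / 4 + 2 * (t ^ 3)⁻¹) ≤ t := by
  have hs : 1 ≤ √t := Real.one_le_sqrt.2 ht
  obtain ⟨s, hs1, rfl⟩ : ∃ s : ℝ, 1 ≤ s ∧ t = s ^ 2 :=
    ⟨√t, hs, (Real.sq_sqrt (by linarith)).symm⟩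
  have hs0 : 0 < s := by linarith
  rw [airyPhaseDeriv, Real.sqrt_sq hs0.le]
  have e : (s + (s ^ 2)⁻¹ / 4 - ((s ^ 2) ^ 2)⁻¹) ^ 2
      - (1 / (2 * s) - ((s ^ 2) ^ 2)⁻¹ / 4 + 2 * ((s ^ 2) ^ 3)⁻¹)
      = s ^ 2 - (32 * s ^ 5 - 5 * s ^ 4 + 40 * s ^ 2 - 16) / (16 * s ^ 8) := by
    field_simp
    ring
  rw [e]
  have h4 : 1 ≤ s ^ 4 := one_le_pow₀ hs1
  have h5 : s ^ 4 ≤ s ^ 5 := pow_le_pow_right₀ hs1 (by norm_num)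
  have h2 : 1 ≤ s ^ 2 := one_le_pow₀ hs1
  have : 0 ≤ (32 * s ^ 5 - 5 * s ^ 4 + 40 * s ^ 2 - 16) / (16 * s ^ 8) :=
    div_nonneg (by linarith) (by positivity)
  linarith

theorem exp_neg_airyPhase_le {t : ℝ} (ht : 1 ≤ t) :
    Real.exp (-airyPhase t) ≤ t ^ (-(1 / 4) : ℝ) * Real.exp (-(2 / 3) * t ^ (3 / 2 : ℝ)) := by
  rw [Real.rpow_def_of_pos (by linarith), ← Real.exp_add, Real.exp_le_exp, airyPhase]
  have : 0 < t⁻¹ := by positivity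
  linarith

/-- Airy-type decay at `-∞` of nonnegative solutions of subexponential growth there. -/
theorem isBigO_atBot_of_solution {p : ℝ} {U U' : ℝ → ℝ}
    (hU : ∀ x, HasDerivAt U (U' x) x) (hU' : ∀ x, HasDerivAt U' (U x * (U x ^ p - x)) x)
    (h0 : ∀ x, 0 ≤ U x) (hsmall : Tendsto (fun t => U (-t) / Real.exp t) atTop (𝓝 0)) :
    U =O[atBot] fun x : ℝ =>
      |x| ^ (-(1 / 4) : ℝ) * Real.exp (-(2 / 3) * |x| ^ (3 / 2 : ℝ)) := by
  set C : ℝ := U (-1) / Real.exp (-airyPhase 1) with hC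
  have hC0 : 0 ≤ C := div_nonneg (h0 _) (Real.exp_pos _).le
  have hV : ∀ t, HasDerivAt (fun t => U (-t)) (-U' (-t)) t := fun t =>
    ((hU (-t)).comp t (hasDerivAt_neg t)).congr_deriv (by ring)
  have hV' : ∀ t, HasDerivAt (fun t => -U' (-t)) (U (-t) * (U (-t) ^ p + t)) t := fun t =>
    ((hU' (-t)).comp t (hasDerivAt_neg t)).neg.congr_deriv (by ring)
  have hb : ∀ t, 1 ≤ t → HasDerivAt (fun t => Real.exp (-airyPhase t))
      (-airyPhaseDeriv t * Real.exp (-airyPhase t)) t := fun t ht =>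
    (hasDerivAt_airyPhase ht).neg.exp.congr_deriv (by simp; ring)
  have hb' : ∀ t, 1 ≤ t → HasDerivAt (fun t => -airyPhaseDeriv t * Real.exp (-airyPhase t))
      ((airyPhaseDeriv t ^ 2 - (1 / (2 * √t) - (t ^ 2)⁻¹ / 4 + 2 * (t ^ 3)⁻¹))
        * Real.exp (-airyPhase t)) t := fun t ht =>
    ((hasDerivAt_airyPhaseDeriv ht).neg.mul (hb t ht)).congr_deriv (by simp; ring)
  -- The reflected solution `V` has `V'' ≥ t V`, so `V - C b` is convex enough for the half-line
  -- principle once `t ≥ 1`; `C` makes it vanish at `t = 1`.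
  have main : ∀ t, 1 ≤ t → U (-t) ≤ C * Real.exp (-airyPhase t) := by
    intro t ht
    refine sub_nonpos.1 (nonpos_of_le_deriv2 (fun t ht => (hV t).sub ((hb t ht).const_mul C))
      (fun t ht => (hV' t).sub ((hb' t ht).const_mul C)) (fun t ht hw => ?_) ?_ ?_ ht)
    · have e1 : (airyPhaseDeriv t ^ 2 - (1 / (2 * √t) - (t ^ 2)⁻¹ / 4 + 2 * (t ^ 3)⁻¹))
          * (C * Real.exp (-airyPhase t)) ≤ t * (C * Real.exp (-airyPhase t)) :=
        mul_le_mul_of_nonneg_right (airyPhase_riccati ht) (mul_nonneg hC0 (Real.exp_pos _).le)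
      have e2 : 0 ≤ U (-t) * U (-t) ^ p := mul_nonneg (h0 _) (Real.rpow_nonneg (h0 _) p)
      simp only [Pi.sub_apply] at hw ⊢
      nlinarith
    · simp only [Pi.sub_apply, hC]
      rw [div_mul_cancel₀ _ (Real.exp_pos _).ne', sub_self]
    · have h1 : Tendsto (fun t => C * (Real.exp (-airyPhase t) / Real.exp t)) atTop (𝓝 (C * 0)) := by
        refine Tendsto.const_mul C ?_
        refine squeeze_zero' (Eventually.of_forall fun t => by positivity) ?_
          Real.tendsto_exp_neg_atTop_nhds_zero
        filter_upwards [eventually_ge_atTop (1 : ℝ)] with t ht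
        rw [Real.exp_neg t, ← one_div]
        gcongr
        rw [Real.exp_le_one_iff, airyPhase]
        have := Real.log_nonneg ht
        have : 0 ≤ 2 / 3 * t ^ (3 / 2 : ℝ) + Real.log t / 4 + t⁻¹ := by positivity
        linarith
      simpa [sub_div, mul_div_assoc] using hsmall.sub h1
  refine IsBigO.of_bound C ?_
  filter_upwards [eventually_le_atBot (-1 : ℝ)] with x hx
  have h1 := main (-x) (by linarith)
  rw [neg_neg] at h1
  have hax : |x| = -x := abs_of_nonpos (by linarith)
  rw [Real.norm_of_nonneg (h0 x), Real.norm_of_nonneg (by positivity), hax]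
  exact h1.trans (mul_le_mul_of_nonneg_left (exp_neg_airyPhase_le (by linarith)) hC0)

/-! ### Algebraic asymptotics at `+∞` -/

theorem restoring_force_of_ge {p x u : ℝ} (hp : 1 < p) (hx : 0 < x) (hu : x ^ (1 / p) ≤ u) :
    x / 2 * (u - x ^ (1 / p)) ≤ u * (u ^ p - x) := by
  set b := x ^ (1 / p) with hb
  have hb0 : 0 < b := Real.rpow_pos_of_pos hx _
  have hbp : b ^ p = x := by
    rw [hb, ← Real.rpow_mul hx.le, one_div_mul_cancel (by linarith), Real.rpow_one]
  have hq : 1 ≤ u / b := (one_le_div hb0).2 hu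
  have h1 : u / b ≤ (u / b) ^ p := by
    simpa using Real.rpow_le_rpow_of_exponent_le hq hp.le
  rw [Real.div_rpow (hb0.le.trans hu) hb0.le, hbp, div_le_div_iff₀ hb0 hx] at h1
  have h3 : x * (u - b) ≤ b * (u ^ p - x) := by linarith
  have h4 : 0 ≤ u ^ p - x := by
    have := mul_nonneg hx.le (sub_nonneg.2 hu)
    nlinarith
  have h5 : b * (u ^ p - x) ≤ u * (u ^ p - x) := mul_le_mul_of_nonneg_right hu h4
  nlinarith [mul_nonneg hx.le (sub_nonneg.2 hu)]

/-- Below `b = x^(1/p)`, `(u / b)^p ≤ u / b` gives `b (u^p - x) ≤ x (u - b)`. The factor lost in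
replacing `b` by `u` is at most `2`, because `u ≥ b / 2`. -/
theorem restoring_force_of_le {p x u : ℝ} (hp : 1 < p) (hx : 0 < x) (hu : u ≤ x ^ (1 / p))
    (hl : x ^ (1 / p) / 2 ≤ u) : u * (u ^ p - x) ≤ x / 2 * (u - x ^ (1 / p)) := by
  set b := x ^ (1 / p) with hb
  have hb0 : 0 < b := Real.rpow_pos_of_pos hx _
  have hu0 : 0 < u := by linarith
  have hbp : b ^ p = x := by
    rw [hb, ← Real.rpow_mul hx.le, one_div_mul_cancel (by linarith), Real.rpow_one]
  have h1 : (u / b) ^ p ≤ u / b := by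
    simpa using Real.rpow_le_rpow_of_exponent_ge (div_pos hu0 hb0) ((div_le_one hb0).2 hu) hp.le
  rw [Real.div_rpow hu0.le hb0.le, hbp, div_le_div_iff₀ hx hb0] at h1
  have h3 : b * (u ^ p - x) ≤ x * (u - b) := by linarith
  have h4 : u ^ p - x ≤ 0 := by
    have := mul_nonneg hx.le (sub_nonneg.2 hu)
    nlinarith
  nlinarith

/-- Asymptotics at `+∞` of solutions that stay above `x^(1/p) / 2`. -/
theorem isBigO_atTop_of_solution {p : ℝ} (hp : 1 < p) {U U' : ℝ → ℝ}
    (hU : ∀ x, HasDerivAt U (U' x) x) (hU' : ∀ x, HasDerivAt U' (U x * (U x ^ p - x)) x)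
    (hlow : ∀ᶠ x in atTop, x ^ (1 / p) / 2 ≤ U x)
    (hsmall : Tendsto (fun x => (U x - x ^ (1 / p)) / Real.exp x) atTop (𝓝 0)) :
    (fun x : ℝ => U x - x ^ (1 / p)) =O[atTop] fun x : ℝ => x ^ ((1 - 3 * p) / p) := by
  have hexp : (1 - 3 * p) / p = 1 / p - 3 := by field_simp
  rw [hexp]
  obtain ⟨X₀, hX₀⟩ := eventually_atTop.1 hlow
  set X := max X₀ 4 with hX
  have hX4 : 4 ≤ X := le_max_right _ _
  have hlowX : ∀ x, X ≤ x → x ^ (1 / p) / 2 ≤ U x := fun x hx => hX₀ x ((le_max_left _ _).trans hx)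
  set β : ℝ := 1 / p with hβ
  have hβ0 : 0 < β := by positivity
  have hβ1 : β < 1 := by rw [hβ, div_lt_one (by linarith)]; exact hp
  -- `C ≥ 4` and `x ≥ 4` let half the force of `C x^(β-3)`, of order `x^(β-2)`, dominate both
  -- `(x^β)''` and the barrier's own second derivative. The other entry handles the endpoint `X`.
  set C : ℝ := max 4 (|U X - X ^ β| / X ^ (β - 3)) with hC
  have hC4 : 4 ≤ C := le_max_left _ _
  have main : ∀ σ : ℝ, σ = 1 ∨ σ = -1 → ∀ x, X ≤ x → σ * (U x - x ^ β) ≤ C * x ^ (β - 3) := by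
    intro σ hσ x hx
    have hr : ∀ (q : ℝ) (x : ℝ), X ≤ x → HasDerivAt (fun x : ℝ => x ^ q) (q * x ^ (q - 1)) x :=
      fun q x hx => Real.hasDerivAt_rpow_const (Or.inl (by linarith))
    refine sub_nonpos.1 (nonpos_of_le_deriv2
      (fun x hx => (((hU x).sub (hr β x hx)).const_mul σ).sub ((hr (β - 3) x hx).const_mul C))
      (fun x hx => (((hU' x).sub ((hr (β - 1) x hx).const_mul β)).const_mul σ).sub
        (((hr (β - 3 - 1) x hx).const_mul (β - 3)).const_mul C))
      (fun x hx hw => ?_) ?_ ?_ hx)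
    · have hx4 : 4 ≤ x := hX4.trans hx
      have hx0 : 0 < x := by linarith
      simp only [Pi.sub_apply] at hw ⊢
      set z := x ^ (β - 3) with hz
      have hz0 : 0 < z := Real.rpow_pos_of_pos hx0 _
      have e1 : x ^ (β - 1 - 1) = x * z := by
        rw [hz, mul_comm, ← Real.rpow_add_one hx0.ne']; congr 1; ring
      have e2 : x ^ (β - 3 - 1 - 1) = z / x ^ 2 := by
        rw [hz, ← Real.rpow_natCast x 2, ← Real.rpow_sub hx0]; congr 1; push_cast; ring
      rw [e1, e2]
      have hCz : 0 < C * z := by positivity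
      have hforce : x / 2 * (σ * (U x - x ^ β)) ≤ σ * (U x * (U x ^ p - x)) := by
        rcases hσ with rfl | rfl
        · have := restoring_force_of_ge hp hx0 (u := U x) (by linarith)
          linarith
        · have := restoring_force_of_le hp hx0 (u := U x) (by linarith) (hlowX x hx)
          linarith
      have hσb : σ * (β * ((β - 1) * (x * z))) ≤ x * z := by
        have h1 : 0 < x * z := by positivity
        have h2 : σ * (β * (β - 1)) ≤ 1 := by
          rcases hσ with rfl | rfl <;> nlinarith
        nlinarith
      have hzz : (β - 3) * ((β - 3 - 1) * (z / x ^ 2)) ≤ 12 * (z / 16) := by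
        have h1 : z / x ^ 2 ≤ z / 16 := by
          gcongr; nlinarith
        have h2 : 0 ≤ z / x ^ 2 := by positivity
        have h3 : (β - 3) * (β - 3 - 1) ≤ 12 := by nlinarith
        have h4 : 0 ≤ (β - 3) * (β - 3 - 1) := by nlinarith
        calc (β - 3) * ((β - 3 - 1) * (z / x ^ 2)) = (β - 3) * (β - 3 - 1) * (z / x ^ 2) := by ring
          _ ≤ 12 * (z / 16) := mul_le_mul h3 h1 h2 (by norm_num)
      have hCzz := mul_le_mul_of_nonneg_left hzz (by linarith : 0 ≤ C)
      have hbal : x * z + C * (12 * (z / 16)) ≤ x / 2 * (C * z) := by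
        have h1 : 0 ≤ (C - 4) * (x * z) := by
          have : 0 ≤ C - 4 := by linarith
          positivity
        have h2 : 0 ≤ (x - 4) * (C * z) := mul_nonneg (by linarith) hCz.le
        nlinarith
      nlinarith
    · have hXpos : 0 < X ^ (β - 3) := Real.rpow_pos_of_pos (by linarith) _
      have h1 : |U X - X ^ β| ≤ C * X ^ (β - 3) := (div_le_iff₀ hXpos).1 (le_max_right _ _)
      have h2 : σ * (U X - X ^ β) ≤ |U X - X ^ β| := by
        rcases hσ with rfl | rfl
        · rw [one_mul]; exact le_abs_self _
        · rw [neg_one_mul]; exact neg_le_abs _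
      simp only [Pi.sub_apply]
      linarith
    · have h1 : Tendsto (fun x : ℝ => x ^ (β - 3)) atTop (𝓝 0) := by
        have := tendsto_rpow_neg_atTop (y := 3 - β) (by linarith)
        simpa using this
      have h2 := (h1.mul Real.tendsto_exp_neg_atTop_nhds_zero).const_mul C
      have h3 := (hsmall.const_mul σ).sub h2
      simp only [mul_zero, sub_zero] at h3
      refine h3.congr fun x => ?_
      simp only [Pi.sub_apply]
      rw [Real.exp_neg]
      ring
  refine IsBigO.of_bound C ?_
  filter_upwards [eventually_ge_atTop X] with x hx
  have hx0 : 0 < x := by linarith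
  rw [Real.norm_eq_abs, Real.norm_of_nonneg (Real.rpow_nonneg hx0.le _), abs_le]
  have h1 := main 1 (Or.inl rfl) x hx
  have h2 := main (-1) (Or.inr rfl) x hx
  constructor <;> linarith

/-! ### Regularity and uniqueness of the Cauchy problem -/

theorem contDiff_two_of_hasDerivAt {u u' u'' : ℝ → ℝ} (hu : ∀ x, HasDerivAt u (u' x) x)
    (hu' : ∀ x, HasDerivAt u' (u'' x) x) (hc : Continuous u'') : ContDiff ℝ 2 u := by
  have h1 : deriv u = u' := funext fun x => (hu x).deriv
  have h2 : deriv u' = u'' := funext fun x => (hu' x).deriv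
  rw [show (2 : WithTop ℕ∞) = 1 + 1 from one_add_one_eq_two.symm, contDiff_succ_iff_deriv, h1,
    contDiff_one_iff_deriv, h2]
  exact ⟨fun x => (hu x).differentiableAt, by simp, fun x => (hu' x).differentiableAt, hc⟩

theorem hasDerivAt_of_contDiff_two {u : ℝ → ℝ} (hu : ContDiff ℝ 2 u) :
    (∀ x, HasDerivAt u (deriv u x) x) ∧ ∀ x, HasDerivAt (deriv u) (deriv (deriv u) x) x := by
  rw [show (2 : WithTop ℕ∞) = 1 + 1 from one_add_one_eq_two.symm, contDiff_succ_iff_deriv,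
    contDiff_one_iff_deriv] at hu
  exact ⟨fun x => (hu.1 x).hasDerivAt, fun x => (hu.2.2.1 x).hasDerivAt⟩

/-- Forward uniqueness for `u'' = a u` with vanishing Cauchy data. -/
theorem eq_zero_of_linear_ode {u u' a : ℝ → ℝ} (hu : ∀ x, HasDerivAt u (u' x) x)
    (hu' : ∀ x, HasDerivAt u' (a x * u x) x) (ha : Continuous a) {x₀ : ℝ} (h0 : u x₀ = 0)
    (h0' : u' x₀ = 0) {x : ℝ} (hx : x₀ ≤ x) : u x = 0 := by
  obtain ⟨M, hM⟩ := isCompact_Icc.exists_bound_of_continuousOn (s := Set.Icc x₀ x) ha.continuousOn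
  -- Grönwall for the energy `u² + u'²`.
  have hE : ∀ y, HasDerivAt (fun y => u y ^ 2 + u' y ^ 2)
      (2 * (1 + a y) * (u y * u' y)) y := fun y =>
    (((hu y).pow 2).add ((hu' y).pow 2)).congr_deriv (by simp; ring)
  have h := eq_zero_of_abs_deriv_le_mul_abs_self_of_eq_zero_right (a := x₀) (b := x)
    (K := 1 + M) (fun y _ => (hE y).continuousAt.continuousWithinAt)
    (fun y _ => (hE y).hasDerivWithinAt) (by simp [h0, h0']) (fun y hy => by
      have h1 := hM y ⟨hy.1, hy.2.le⟩
      rw [Real.norm_eq_abs] at h1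
      have h2 : |1 + a y| ≤ 1 + M := (abs_add_le _ _).trans (by simpa using h1)
      have h3 : 2 * |u y * u' y| ≤ u y ^ 2 + u' y ^ 2 := by
        rw [abs_mul]
        nlinarith [sq_nonneg (|u y| - |u' y|), sq_abs (u y), sq_abs (u' y)]
      rw [Real.norm_eq_abs, Real.norm_of_nonneg (by positivity), abs_mul, abs_mul, abs_two]
      nlinarith [mul_le_mul h2 h3 (by positivity) ((abs_nonneg _).trans h2)])
    x ⟨hx, le_rfl⟩
  nlinarith [sq_nonneg (u x), sq_nonneg (u' x)]

/-! ### Qualitative properties, uniqueness and non-degeneracy -/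

namespace IsGenHastingsMcLeod

variable {p : ℝ} {U V : ℝ → ℝ}

theorem hasDerivAt (h : IsGenHastingsMcLeod p U) (x : ℝ) : HasDerivAt U (deriv U x) x :=
  (hasDerivAt_of_contDiff_two h.solution.1).1 x

theorem hasDerivAt_deriv (h : IsGenHastingsMcLeod p U) (x : ℝ) :
    HasDerivAt (deriv U) (U x * (U x ^ p - x)) x := by
  refine ((hasDerivAt_of_contDiff_two h.solution.1).2 x).congr_deriv ?_
  have := h.solution.2 x
  rw [abs_of_nonneg (h.nonneg x)] at this
  linarith

theorem tendsto_atTop_atTop (hp : 1 < p) (h : IsGenHastingsMcLeod p U) :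
    Tendsto U atTop atTop := by
  have h1 := h.tendsto_atTop.add_atTop (tendsto_rpow_atTop (y := 1 / p) (by positivity))
  exact h1.congr fun x => by ring

/-- A zero of `U ≥ 0` is a minimum, so the Cauchy data vanish there. Viewing the equation as linear
with coefficient `U^p - x`, `U` would vanish to the right, against its growth. -/
theorem pos (hp : 1 < p) (h : IsGenHastingsMcLeod p U) (x : ℝ) : 0 < U x := by
  refine (h.nonneg x).lt_of_ne fun h0 => ?_
  have hmin : IsLocalMin U x := Eventually.of_forall fun y => by rw [← h0]; exact h.nonneg y
  have hc : Continuous U := h.solution.1.continuous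
  have ha : Continuous fun x => U x ^ p - x :=
    (hc.rpow_const fun x => Or.inr (by linarith)).sub continuous_id
  have hz : ∀ y, x ≤ y → U y = 0 := fun y hy =>
    eq_zero_of_linear_ode h.hasDerivAt
      (fun y => (h.hasDerivAt_deriv y).congr_deriv (mul_comm _ _)) ha h0.symm hmin.deriv_eq_zero hy
  obtain ⟨y, hy1, hy2⟩ :=
    ((h.tendsto_atTop_atTop hp).eventually_ge_atTop 1 |>.and (eventually_ge_atTop x)).exists
  linarith [hz y hy2]

theorem isBigO_atBot (h : IsGenHastingsMcLeod p U) : U =O[atBot] fun x : ℝ =>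
    |x| ^ (-(1 / 4) : ℝ) * Real.exp (-(2 / 3) * |x| ^ (3 / 2 : ℝ)) := by
  refine isBigO_atBot_of_solution h.hasDerivAt h.hasDerivAt_deriv h.nonneg ?_
  have h1 := (h.tendsto_atBot.comp tendsto_neg_atTop_atBot).mul
    Real.tendsto_exp_neg_atTop_nhds_zero
  rw [zero_mul] at h1
  exact h1.congr fun t => by rw [Function.comp_apply, Real.exp_neg, div_eq_mul_inv]

theorem isBigO_atTop (hp : 1 < p) (h : IsGenHastingsMcLeod p U) :
    (fun x : ℝ => U x - x ^ (1 / p)) =O[atTop] fun x : ℝ => x ^ ((1 - 3 * p) / p) := by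
  refine isBigO_atTop_of_solution hp h.hasDerivAt h.hasDerivAt_deriv ?_ ?_
  · have h1 : Tendsto (fun x : ℝ => x ^ (1 / p)) atTop atTop :=
      tendsto_rpow_atTop (by positivity)
    filter_upwards [h.tendsto_atTop.eventually_const_lt (show (-1 : ℝ) < 0 by norm_num),
      h1.eventually_ge_atTop 2] with x hx1 hx2
    linarith
  · have h1 := h.tendsto_atTop.mul Real.tendsto_exp_neg_atTop_nhds_zero
    rw [zero_mul] at h1
    exact h1.congr fun t => by rw [Real.exp_neg, ← div_eq_mul_inv]

theorem tendsto_mul_atBot (h : IsGenHastingsMcLeod p U) :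
    Tendsto (fun x => x * U x) atBot (𝓝 0) := by
  refine ((isBigO_refl (fun x : ℝ => x) atBot).mul h.isBigO_atBot).trans_tendsto ?_
  have h1 := (rpow_mul_exp_neg_mul_rpow_isLittleO_exp_neg (3 / 4) (b := 2 / 3) (p := 3 / 2)
    (by norm_num) (by norm_num)).isBigO
  have h2 : Tendsto (fun x : ℝ => Real.exp (-(1 / 2) * x)) atTop (𝓝 0) := by
    have := Real.tendsto_exp_neg_atTop_nhds_zero.comp
      ((tendsto_id (α := ℝ)).const_mul_atTop (show (0 : ℝ) < 1 / 2 by norm_num))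
    exact this.congr fun x => by simp
  have h3 := ((h1.trans_tendsto h2).comp tendsto_neg_atBot_atTop).neg
  rw [neg_zero] at h3
  refine h3.congr' ?_
  filter_upwards [eventually_lt_atBot (0 : ℝ)] with x hx
  have hx' : 0 < -x := by linarith
  rw [abs_of_neg hx, Function.comp_apply, ← mul_assoc, ← neg_mul]
  congr 1
  have : (-x) ^ (3 / 4 : ℝ) = (-x) ^ (-(1 / 4) : ℝ) * (-x) := by
    rw [← Real.rpow_add_one hx'.ne']; norm_num
  rw [this]; ring

/-- `U` is convex on the negative axis, so `U'` lies between backward and forward unit differences,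
which tend to zero. -/
theorem tendsto_deriv_atBot (h : IsGenHastingsMcLeod p U) :
    Tendsto (deriv U) atBot (𝓝 0) := by
  have mono : MonotoneOn (deriv U) (Set.Iic 0) := by
    apply monotoneOn_of_deriv_nonneg (convex_Iic 0)
    · exact fun x _ => (h.hasDerivAt_deriv x).continuousAt.continuousWithinAt
    · exact fun x _ => (h.hasDerivAt_deriv x).differentiableAt.differentiableWithinAt
    · intro x hx
      have hx' : x ∈ Set.Iic (0 : ℝ) := interior_subset hx
      rw [(h.hasDerivAt_deriv x).deriv]
      exact mul_nonneg (h.nonneg x)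
        (sub_nonneg.2 ((Set.mem_Iic.1 hx').trans (Real.rpow_nonneg (h.nonneg x) p)))
  have mvt : ∀ a b, a < b → ∃ c ∈ Set.Ioo a b, deriv U c = (U b - U a) / (b - a) := fun a b hab =>
    exists_hasDerivAt_eq_slope U (deriv U) hab
      (fun x _ => (h.hasDerivAt x).continuousAt.continuousWithinAt) fun x _ => h.hasDerivAt x
  have hl : Tendsto (fun x => U x - U (x - 1)) atBot (𝓝 0) := by
    simpa [← sub_eq_add_neg] using h.tendsto_atBot.sub
      (h.tendsto_atBot.comp (tendsto_atBot_add_const_right atBot (-1 : ℝ) tendsto_id))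
  have hr : Tendsto (fun x => U (x + 1) - U x) atBot (𝓝 0) := by
    simpa using (h.tendsto_atBot.comp
      (tendsto_atBot_add_const_right atBot (1 : ℝ) tendsto_id)).sub h.tendsto_atBot
  refine tendsto_of_tendsto_of_tendsto_of_le_of_le' hl hr ?_ ?_
  · filter_upwards [eventually_le_atBot (0 : ℝ)] with x hx
    obtain ⟨c, hc, hc'⟩ := mvt (x - 1) x (by linarith)
    have := mono (a := c) (b := x) (Set.mem_Iic.2 (by linarith [hc.2])) hx hc.2.le
    rw [hc'] at this
    simpa using this
  · filter_upwards [eventually_le_atBot (-1 : ℝ)] with x hx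
    obtain ⟨c, hc, hc'⟩ := mvt x (x + 1) (by linarith)
    have := mono (a := x) (b := c) (Set.mem_Iic.2 (by linarith))
      (Set.mem_Iic.2 (by linarith [hc.2])) hc.1.le
    rw [hc'] at this
    simpa using this

/-- With `w = V - U` and `ψ = V`, `w'' ψ - w ψ'' = U V (V^p - U^p)`. At `+∞`, `w → 0` while `δ V →
∞`. -/
theorem le (hp : 1 < p) (hU : IsGenHastingsMcLeod p U) (hV : IsGenHastingsMcLeod p V) (x : ℝ) :
    V x ≤ U x := by
  refine sub_nonpos.1 (nonpos_of_wronskian_tendsto_zero (w := V - U)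
    (fun x => (hV.hasDerivAt x).sub (hU.hasDerivAt x))
    (fun x => (hV.hasDerivAt_deriv x).sub (hU.hasDerivAt_deriv x)) hV.hasDerivAt
    hV.hasDerivAt_deriv (hV.pos hp) (fun x hx => ?_) ?_ (fun δ hδ hcon => ?_) x)
  · simp only [Pi.sub_apply] at hx ⊢
    have h1 : U x ^ p < V x ^ p := Real.rpow_lt_rpow (hU.nonneg x) (by linarith) (by linarith)
    have h2 := mul_pos (mul_pos (hU.pos hp x) (hV.pos hp x)) (sub_pos.2 h1)
    nlinarith
  · have h1 := ((hV.tendsto_deriv_atBot.sub hU.tendsto_deriv_atBot).mul hV.tendsto_atBot).sub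
      ((hV.tendsto_atBot.sub hU.tendsto_atBot).mul hV.tendsto_deriv_atBot)
    simpa using h1
  · have h1 : Tendsto (fun x => V x - U x) atTop (𝓝 0) := by
      have := hV.tendsto_atTop.sub hU.tendsto_atTop
      simpa using this
    have h2 := (hV.tendsto_atTop_atTop hp).const_mul_atTop hδ
    obtain ⟨x, hx1, hx2, hx3⟩ := (hcon.and ((h2.eventually_ge_atTop 1).and
      (h1.eventually_lt_const (show (0 : ℝ) < 1 by norm_num)))).exists
    simp only [Pi.sub_apply] at hx1
    linarith

/-- With `w = -U'` and `ψ = U`, differentiating the equation gives `w'' ψ - w ψ'' = p U^(p+1) w +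
U²`. At `+∞`, `-U' ≥ δ U` would make `U` decrease. -/
theorem deriv_pos (hp : 1 < p) (h : IsGenHastingsMcLeod p U) (x : ℝ) : 0 < deriv U x := by
  have hUp : ∀ x, HasDerivAt (fun x => U x * (U x ^ p - x))
      (((p + 1) * U x ^ p - x) * deriv U x - U x) x := by
    intro x
    have hne := (h.pos hp x).ne'
    refine ((h.hasDerivAt x).mul (((h.hasDerivAt x).rpow_const (p := p) (Or.inl hne)).sub
      (hasDerivAt_id x))).congr_deriv ?_
    have : U x ^ (p - 1) * U x = U x ^ p := by
      rw [← Real.rpow_add_one hne]; congr 1; ring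
    simp only [id, Pi.sub_apply]
    linear_combination p * deriv U x * this
  have key : ∀ x, 0 ≤ -deriv U x → -deriv U x * (U x * (U x ^ p - x)) <
      -(((p + 1) * U x ^ p - x) * deriv U x - U x) * U x := by
    intro x hx
    have h1 := h.pos hp x
    have h2 : 0 ≤ p * U x ^ p * U x * -deriv U x := by
      have := Real.rpow_nonneg h1.le p
      positivity
    nlinarith [mul_pos h1 h1]
  have hle : ∀ x, -deriv U x ≤ 0 := by
    refine nonpos_of_wronskian_tendsto_zero (w := fun x => -deriv U x)
      (fun x => (h.hasDerivAt_deriv x).neg) (fun x => (hUp x).neg) h.hasDerivAt h.hasDerivAt_deriv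
      (h.pos hp) (fun x hx => key x hx.le) ?_ fun δ hδ hcon => ?_
    · have e1 : Tendsto (fun x => U x ^ p) atBot (𝓝 (0 ^ p)) :=
        h.tendsto_atBot.rpow_const (Or.inr (by linarith))
      have e2 := ((h.tendsto_atBot.mul h.tendsto_mul_atBot).sub
        ((h.tendsto_atBot.mul h.tendsto_atBot).mul e1)).add
        (h.tendsto_deriv_atBot.mul h.tendsto_deriv_atBot)
      simp only [mul_zero, zero_mul, sub_zero, add_zero] at e2
      exact e2.congr fun x => by ring
    · obtain ⟨X, hX⟩ := eventually_atTop.1 hcon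
      have anti : AntitoneOn U (Set.Ici X) := by
        apply antitoneOn_of_deriv_nonpos (convex_Ici X)
        · exact fun x _ => (h.hasDerivAt x).continuousAt.continuousWithinAt
        · exact fun x _ => (h.hasDerivAt x).differentiableAt.differentiableWithinAt
        · intro x hx
          have hx' : x ∈ Set.Ici X := interior_subset hx
          have := hX x hx'
          have := mul_nonneg hδ.le (h.nonneg x)
          linarith
      obtain ⟨y, hy1, hy2⟩ := (((h.tendsto_atTop_atTop hp).eventually_gt_atTop (U X)).and
        (eventually_ge_atTop X)).exists
      exact absurd (anti Set.self_mem_Ici hy2 hy2) (not_le.2 hy1)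
  -- At a zero of `U' ≥ 0`, minimality gives `U'' = 0`, but `U''' = -U < 0` makes the point a local
  -- maximum of `U'` as well; `U'` would be locally constant, forcing `U = 0`.
  refine (neg_nonpos.1 (hle x)).lt_of_ne fun h0 => ?_
  have hmin : IsLocalMin (deriv U) x := Eventually.of_forall fun y => by
    rw [← h0]; exact neg_nonpos.1 (hle y)
  have h1 : U x * (U x ^ p - x) = 0 := by
    rw [← (h.hasDerivAt_deriv x).deriv]; exact hmin.deriv_eq_zero
  have hder : HasDerivAt (deriv (deriv U)) (((p + 1) * U x ^ p - x) * deriv U x - U x) x := by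
    have : deriv (deriv U) = fun x => U x * (U x ^ p - x) :=
      funext fun x => (h.hasDerivAt_deriv x).deriv
    rw [this]; exact hUp x
  have hmax : IsLocalMax (deriv U) x := by
    refine isLocalMax_of_deriv_deriv_neg ?_ ?_ (h.hasDerivAt_deriv x).continuousAt
    · rw [hder.deriv, ← h0, mul_zero, zero_sub]
      exact neg_neg_of_pos (h.pos hp x)
    · rw [(h.hasDerivAt_deriv x).deriv, h1]
  have hconst : deriv U =ᶠ[𝓝 x] fun _ => deriv U x := by
    filter_upwards [hmin, hmax] with y h1 h2
    exact le_antisymm h2 h1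
  have h2 : deriv (deriv (deriv U)) x = 0 := by
    have h3 : deriv (deriv U) =ᶠ[𝓝 x] fun _ => 0 := by
      simpa using hconst.deriv
    simpa using h3.deriv_eq
  rw [hder.deriv, ← h0] at h2
  linarith [h.pos hp x]

/-- For `w = φ` and `ψ = U`, `w'' ψ - w ψ'' = p U^(p+1) φ`, so `φ ≤ 0`; the same holds for `-φ`. -/
theorem isNonDegenerate (hp : 1 < p) (h : IsGenHastingsMcLeod p U) : IsNonDegenerate p U := by
  have main : ∀ φ : ℝ → ℝ, ContDiff ℝ 2 φ →
      (∀ x : ℝ, deriv (deriv φ) x - ((p + 1) * U x ^ p - x) * φ x = 0) →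
      (∃ C : ℝ, ∀ x : ℝ, |φ x| ≤ C) → ∀ x : ℝ, φ x ≤ 0 := by
    rintro φ hφ hode ⟨C, hC⟩
    obtain ⟨h1, h2⟩ := hasDerivAt_of_contDiff_two hφ
    have hC0 : 0 ≤ C := (abs_nonneg _).trans (hC 0)
    have hode' : ∀ x, deriv (deriv φ) x = ((p + 1) * U x ^ p - x) * φ x := fun x => by
      linarith [hode x]
    have hmono : Monotone U := monotone_of_deriv_nonneg (fun x => (h.hasDerivAt x).differentiableAt)
      fun x => (h.deriv_pos hp x).le
    set D : ℝ := (p + 1) * U 0 ^ p with hD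
    have hD0 : 0 ≤ D := mul_nonneg (by linarith) (Real.rpow_nonneg (h.nonneg 0) p)
    -- Two mean value steps on `[x, x + 1]` bound `φ'` linearly in `|x|`, which suffices for `φ' U →
    -- 0` because `x U → 0`.
    have hφ' : ∀ x ≤ -1, |deriv φ x| ≤ C * (2 + D - x) := by
      intro x hx
      obtain ⟨c, hc, hc'⟩ := exists_hasDerivAt_eq_slope φ (deriv φ) (show x < x + 1 by linarith)
        (fun x _ => (h1 x).continuousAt.continuousWithinAt) fun x _ => h1 x
      obtain ⟨d, hd, hd'⟩ := exists_hasDerivAt_eq_slope (deriv φ) (deriv (deriv φ)) hc.1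
        (fun x _ => (h2 x).continuousAt.continuousWithinAt) fun x _ => h2 x
      have e1 : |deriv φ c| ≤ C + C := by
        rw [hc', add_sub_cancel_left, div_one]
        exact (abs_sub _ _).trans (add_le_add (hC _) (hC _))
      have hcx : 0 < c - x := sub_pos.2 hc.1
      rw [eq_div_iff hcx.ne'] at hd'
      have hd0 : d < 0 := by linarith [hd.2, hc.2]
      have e2 : |deriv (deriv φ) d| ≤ (D - x) * C := by
        rw [hode' d, abs_mul]
        have hUd : (p + 1) * U d ^ p ≤ D := by
          have := Real.rpow_le_rpow (h.nonneg d) (hmono hd0.le) (by linarith : 0 ≤ p)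
          exact mul_le_mul_of_nonneg_left this (by linarith)
        have hUd0 : 0 ≤ (p + 1) * U d ^ p :=
          mul_nonneg (by linarith) (Real.rpow_nonneg (h.nonneg d) p)
        rw [abs_of_nonneg (by linarith : 0 ≤ (p + 1) * U d ^ p - d)]
        exact mul_le_mul (by linarith [hd.1]) (hC d) (abs_nonneg _) (by linarith)
      have e3 : |deriv (deriv φ) d * (c - x)| ≤ (D - x) * C := by
        rw [abs_mul, abs_of_pos hcx]
        exact (mul_le_of_le_one_right (abs_nonneg _) (by linarith [hc.2])).trans e2
      have e4 : deriv φ x = deriv φ c - deriv (deriv φ) d * (c - x) := by linarith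
      rw [e4]
      refine (abs_sub _ _).trans ((add_le_add e1 e3).trans (le_of_eq (by ring)))
    refine nonpos_of_wronskian_tendsto_zero h1 h2 h.hasDerivAt h.hasDerivAt_deriv (h.pos hp)
      (fun x hx => ?_) ?_ fun δ hδ hcon => ?_
    · rw [hode' x]
      have hUx := h.pos hp x
      have := mul_pos (mul_pos (mul_pos (by linarith : 0 < p) (Real.rpow_pos_of_pos hUx p)) hUx) hx
      nlinarith
    · have e1 : Tendsto (fun x => deriv φ x * U x) atBot (𝓝 0) := by
        have e2 := ((h.tendsto_atBot.const_mul (2 + D)).sub h.tendsto_mul_atBot).const_mul C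
        simp only [mul_zero, sub_zero] at e2
        refine squeeze_zero_norm' ?_ e2
        filter_upwards [eventually_le_atBot (-1 : ℝ)] with x hx
        rw [norm_mul, Real.norm_eq_abs, Real.norm_of_nonneg (h.nonneg x)]
        refine (mul_le_mul_of_nonneg_right (hφ' x hx) (h.nonneg x)).trans (le_of_eq (by ring))
      have e3 : Tendsto (fun x => φ x * deriv U x) atBot (𝓝 0) := by
        have e4 := h.tendsto_deriv_atBot.norm.const_mul C
        simp only [norm_zero, mul_zero] at e4
        refine squeeze_zero_norm (fun x => ?_) e4
        rw [norm_mul]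
        exact mul_le_mul_of_nonneg_right (hC x) (norm_nonneg _)
      simpa using e1.sub e3
    · obtain ⟨x, hx1, hx2⟩ := (hcon.and (((h.tendsto_atTop_atTop hp).const_mul_atTop
        hδ).eventually_gt_atTop C)).exists
      linarith [le_abs_self (φ x), hC x]
  rintro φ hφ hode ⟨C, hC⟩ x
  refine le_antisymm (main φ hφ hode ⟨C, hC⟩ x) ?_
  have := main (fun x => -φ x) hφ.neg (fun x => by
    have e1 : deriv (fun x => -φ x) = fun x => -deriv φ x := funext fun y => deriv.fun_neg
    rw [e1, deriv.fun_neg]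
    linarith [hode x]) ⟨C, fun x => by rw [abs_neg]; exact hC x⟩ x
  linarith

end IsGenHastingsMcLeod

/-! ### Existence and conclusion -/

theorem exists_isGenHastingsMcLeod {p : ℝ} (hp : 1 < p) : ∃ U : ℝ → ℝ, IsGenHastingsMcLeod p U := by
  obtain ⟨U, U', hU, hU', h0, hup, hlow⟩ := exists_solution_between_barriers hp
  have hc : Continuous U := continuous_iff_continuousAt.2 fun x => (hU x).continuousAt
  have hpoly : Tendsto (fun x : ℝ => 2 * (1 + x ^ 2) / Real.exp x) atTop (𝓝 0) := by
    have h1 := (Real.tendsto_exp_neg_atTop_nhds_zero.add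
      (Real.tendsto_pow_mul_exp_neg_atTop_nhds_zero 2)).const_mul 2
    simp only [add_zero, mul_zero] at h1
    exact h1.congr fun x => by rw [Real.exp_neg]; ring
  have hbot := isBigO_atBot_of_solution hU hU' h0 (by
    refine squeeze_zero (fun t => div_nonneg (h0 _) (Real.exp_pos _).le) (fun t => ?_) hpoly
    have := (hup (-t)).trans (upperBarrier_le hp (-t))
    rw [neg_sq] at this
    gcongr)
  have htop := isBigO_atTop_of_solution hp hU hU' (by
    filter_upwards [eventually_ge_atTop (4 : ℝ)] with x hx
    refine le_trans ?_ (hlow x (by linarith))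
    -- For `x ≥ 4`, `x - 2 ≥ x / 2`, and `2^(1/p) ≤ 2` turns this into the lower bound `x^(1/p) /
    -- 2`.
    have e1 : (x / 2) ^ (1 / p) ≤ (x - 2) ^ (1 / p) :=
      Real.rpow_le_rpow (by linarith) (by linarith) (by positivity)
    refine le_trans ?_ e1
    rw [Real.div_rpow (by linarith) (by norm_num)]
    have e2 : (2 : ℝ) ^ (1 / p) ≤ 2 := by
      simpa using Real.rpow_le_rpow_of_exponent_le (x := 2) (y := 1 / p) (z := 1) (by norm_num)
        (by rw [div_le_one (by linarith)]; exact hp.le)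
    gcongr) (by
    refine squeeze_zero_norm' ?_ (hpoly.add hpoly |>.trans (by simp))
    filter_upwards [eventually_ge_atTop (1 : ℝ)] with x hx
    rw [norm_div, Real.norm_of_nonneg (Real.exp_pos x).le, ← add_div, Real.norm_eq_abs]
    gcongr
    have e1 : x ^ (1 / p) ≤ x := by
      simpa using Real.rpow_le_rpow_of_exponent_le (y := 1 / p) (z := 1) hx
        (by rw [div_le_one (by linarith)]; exact hp.le)
    have e2 : 0 ≤ x ^ (1 / p) := by positivity
    have e3 := (hup x).trans (upperBarrier_le hp x)
    rw [abs_le]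
    constructor <;> nlinarith [h0 x])
  refine ⟨U, ⟨contDiff_two_of_hasDerivAt hU hU' ?_, fun x => ?_⟩, h0, ?_, ?_⟩
  · have : Continuous fun x => U x ^ p := hc.rpow_const fun x => Or.inr (by linarith)
    fun_prop
  · have h1 : deriv U = U' := funext fun x => (hU x).deriv
    rw [h1, (hU' x).deriv, abs_of_nonneg (h0 x)]
    ring
  · refine hbot.trans_tendsto ?_
    have h1 := (rpow_mul_exp_neg_mul_rpow_isLittleO_exp_neg (-(1 / 4)) (b := 2 / 3) (p := 3 / 2)
      (by norm_num) (by norm_num)).isBigO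
    have h2 : Tendsto (fun x : ℝ => Real.exp (-(1 / 2) * x)) atTop (𝓝 0) := by
      have := Real.tendsto_exp_neg_atTop_nhds_zero.comp
        ((tendsto_id (α := ℝ)).const_mul_atTop (show (0 : ℝ) < 1 / 2 by norm_num))
      exact this.congr fun x => by simp
    exact (h1.trans_tendsto h2).comp tendsto_abs_atBot_atTop
  · refine htop.trans_tendsto ?_
    have := tendsto_rpow_neg_atTop (y := 3 - 1 / p) (by
      have : 1 / p < 1 := by rw [div_lt_one (by linarith)]; exact hp
      linarith)
    refine this.congr fun x => ?_
    congr 1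
    field_simp
    ring

theorem propositionB1 (p : ℝ) (hp : 1 < p) :
    (∃! U : ℝ → ℝ, IsGenHastingsMcLeod p U) ∧
    ∀ U : ℝ → ℝ, IsGenHastingsMcLeod p U →
      (∀ x : ℝ, 0 < deriv U x) ∧
      (U =O[atBot] fun x : ℝ =>
        |x| ^ (-(1 / 4) : ℝ) * Real.exp (-(2 / 3) * |x| ^ (3 / 2 : ℝ))) ∧
      ((fun x : ℝ => U x - x ^ (1 / p)) =O[atTop] fun x : ℝ => x ^ ((1 - 3 * p) / p)) ∧
      IsNonDegenerate p U := by
  refine ⟨?_, fun U h => ⟨h.deriv_pos hp, h.isBigO_atBot, h.isBigO_atTop hp, h.isNonDegenerate hp⟩⟩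
  obtain ⟨U, hU⟩ := exists_isGenHastingsMcLeod hp
  exact ⟨U, hU, fun V hV => funext fun x => le_antisymm (hU.le hp hV x) (hV.le hp hU x)⟩
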